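/- There exist two universal real polynomials $P_c$ (in 16 variables) and $P_\gamma$ (in 18 variables) such that the following holds. Consider $N$ agents with a distance function $\mathrm{dist}:[N]\times[N]\to\mathbb{R}_{\ge 0}$ (symmetric, satisfying the triangle inequality; for instance the graph distance of a connected graph). Agent $i$ has a local state in $\mathbb{R}^{n_x^i}$ and a local control in $\mathbb{R}^{n_u^i}$; put $n_x=\sum_i n_x^i$, $n_u=\sum_i n_u^i$, and let $[X]_{ij}$ be the block of a matrix $X$ with the rows of agent $i$ and the columns of agent $j$. All matrix norms are spectral norms. A matrix $X$ is called $(c,\gamma)$-SED (spatially exponentially decaying) if $\|[X]_{ij}\|\le c\,e^{-\gamma\,\mathrm{dist}(i,j)}$ for all $i,j\in[N]$, and a square matrix $F$ is called $(\tau,e^{-\rho})$-stable if $\|F^k\|\le\tau e^{-\rho k}$ for all integers $k\ge0$. Let $A\in\mathbb{R}^{n_x\times n_x}$, $B\in\mathbb{R}^{n_x\times n_u}$, $Q\in\mathbb{R}^{n_x\times n_x}$, $R\in\mathbb{R}^{n_u\times n_u}$, $S\in\mathbb{R}^{n_u\times n_x}$, and consider the infinite-horizon LQR problem of minimizing $$\lim_{T\to\infty}\frac1T\,\mathbb{E}\sum_{t=0}^{T-1}\bigl(x_t^\top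 Qx_t+u_t^\top Ru_t+2u_t^\top Sx_t\bigr)\quad\text{subject to}\quad x_{t+1}=Ax_t+Bu_t+w_t,$$ with $w_t\sim\mathcal N(0,I)$ i.i.d., over causal, square integrable controls $u_t$ (functions of the deterministic initial state and of $w_0,\dots,w_{t-1}$). Let $K$ be the optimal control gain, that is, the state feedback $u_t=-Kx_t$ attains the minimum from every initial state $x_0$. Assume: 1. $Q\succ0$ and $R-SQ^{-1}S^\top\succ0$; 2. $A,B,Q,R,S$ are $(a,\gamma_{\rm sys})$-, $(b,\gamma_{\rm sys})$-, $(q,\gamma_{\rm sys})$-, $(r,\gamma_{\rm sys})$-, $(s,\gamma_{\rm sys})$-SED respectively, where $\gamma_{\rm sys}>0$, $a,b,q,r\ge1$ and $s>0$; 3. there are $\tau\ge1$, $\rho>0$, $k_0\ge0$ and a $(k_0,\gamma_{\rm sys})$-SED matrix $K_0\in\mathbb{R}^{n_u\times n_x}$ such that $A-BK_0$ is $(\tau,e^{-\rho})$-stable ($A$ itself need not be stable); 4. $A-BK$ is $(\tau,e^{-\rho})$-stable. Then $K$ is $(c_K,\gamma_K)$-SED with $$c_K=P_c\Bigl(N,\tau,\tfrac1{1-e^{-2\rho}},\tfrac1{\lambda_{\min}(R-SQ^{-1}S^\top)},\tfrac1{\lambda_{\min}(Q)},\|B\|,\|Q\|,\|R\|,\|S\|,\|K\|,\|K_0\|^2,b,q,r,s,k_0\Bigr),$$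 $$\gamma_K=\frac{\gamma_{\rm sys}\,\rho}{(1+\rho)\,D},$$ where $D>0$ is the value $$D=P_\gamma\Bigl(\tau,\tfrac1{1-e^{-2\rho}},\tfrac1{\lambda_{\min}(R-SQ^{-1}S^\top)},\tfrac1{\lambda_{\min}(Q)},\lambda_{\max}(R),\|B\|,\|Q\|,\|R\|,\|S\|,\|K_0\|^2,\ln N,\ln a,\ln b,\ln q,\ln r,\ln(1+s),\ln(1+k_0),\ln(1+\gamma_{\rm sys})\Bigr).$$ -/

import Mathlib

open Filter Topology MeasureTheory ProbabilityTheory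
open scoped Matrix Matrix.Norms.L2Operator

noncomputable section

namespace NetworkLQR

/-- Index type of the joint vector `[v¹; …; vᴺ]`, where the local vector of agent `i` has
dimension `n i`. -/
abbrev Idx {N : ℕ} (n : Fin N → ℕ) : Type := Σ i : Fin N, Fin (n i)

/-- The block `[X]ᵢⱼ` of a matrix: rows of agent `i`, columns of agent `j`. -/
def block {N : ℕ} {m n : Fin N → ℕ} (X : Matrix (Idx m) (Idx n) ℝ) (i j : Fin N) :
    Matrix (Fin (m i)) (Fin (n j)) ℝ :=
  X.submatrix (fun k => ⟨i, k⟩) (fun k => ⟨j, k⟩)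

/-- `d` is a distance function on the network of agents: nonnegative, symmetric, and subject to
the triangle inequality. -/
structure IsDistance {N : ℕ} (d : Fin N → Fin N → ℝ) : Prop where
  nonneg : ∀ i j, 0 ≤ d i j
  symm : ∀ i j, d i j = d j i
  triangle : ∀ i j k, d i j ≤ d i k + d k j

/-- `X` is `(c, γ)`-spatially exponential decaying; `‖·‖` is the spectral norm. -/
def IsSED {N : ℕ} (d : Fin N → Fin N → ℝ) {m n : Fin N → ℕ} (c γ : ℝ)
    (X : Matrix (Idx m) (Idx n) ℝ) : Prop :=
  ∀ i j, ‖block X i j‖ ≤ c * Real.exp (-γ * d i j)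

/-- `A` is `(τ, e^{-ρ})`-stable; `‖·‖` is the spectral norm. -/
def IsExpStable {n : Type*} [Fintype n] [DecidableEq n] (τ ρ : ℝ) (A : Matrix n n ℝ) : Prop :=
  ∀ k : ℕ, ‖A ^ k‖ ≤ τ * Real.exp (-ρ * k)

/-- The smallest eigenvalue of a (symmetric) matrix. -/
def lamMin {n : Type*} [Fintype n] [DecidableEq n] (M : Matrix n n ℝ) : ℝ := sInf (spectrum ℝ M)

/-- The largest eigenvalue of a (symmetric) matrix. -/
def lamMax {n : Type*} [Fintype n] [DecidableEq n] (M : Matrix n n ℝ) : ℝ := sSup (spectrum ℝ M)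

section Control

variable {n m : Type*} [Fintype n] [Fintype m] {Ω : Type*} [MeasurableSpace Ω]

/-- `w₀, w₁, …` are independent, each with law `N(0, I)`. -/
structure IsWhiteNoise (μ : Measure Ω) (w : ℕ → Ω → n → ℝ) : Prop where
  measurable : ∀ t, Measurable (w t)
  law : ∀ t, μ.map (w t) = Measure.pi (fun _ => gaussianReal 0 1)
  indep : iIndepFun w μ

/-- The state process `x` and the control process `u` form an admissible pair with initial state
`x₀`: the dynamics `x_{t+1} = A x_t + B u_t + w_t` hold, and `u_t` is a square integrable function
of what is known at time `t`, that is, of the past noise `w₀, …, w_{t-1}`. -/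
structure IsAdmissible (A : Matrix n n ℝ) (B : Matrix n m ℝ) (μ : Measure Ω)
    (w : ℕ → Ω → n → ℝ) (x₀ : n → ℝ) (x : ℕ → Ω → n → ℝ) (u : ℕ → Ω → m → ℝ) : Prop where
  init : ∀ ω, x 0 ω = x₀
  dyn : ∀ t ω, x (t + 1) ω = A *ᵥ x t ω + B *ᵥ u t ω + w t ω
  causal : ∀ t, ∃ g : (Fin t → n → ℝ) → m → ℝ,
    Measurable g ∧ ∀ ω, u t ω = g (fun s => w s ω)
  sq_integrable : ∀ t, MemLp (u t) 2 μ

/-- The stage cost `xᵀ Q x + uᵀ R u + 2 uᵀ S x`. -/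
def stageCost (Q : Matrix n n ℝ) (R : Matrix m m ℝ) (S : Matrix m n ℝ) (x : n → ℝ) (u : m → ℝ) :
    ℝ :=
  x ⬝ᵥ (Q *ᵥ x) + u ⬝ᵥ (R *ᵥ u) + 2 * (u ⬝ᵥ (S *ᵥ x))

/-- The infinite-horizon average cost `lim (1/T) E ∑_{t<T} (stage cost)` exists and equals `c`. -/
def HasAverageCost (Q : Matrix n n ℝ) (R : Matrix m m ℝ) (S : Matrix m n ℝ) (μ : Measure Ω)
    (x : ℕ → Ω → n → ℝ) (u : ℕ → Ω → m → ℝ) (c : ℝ) : Prop :=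
  Tendsto (fun T : ℕ => (1 / (T : ℝ)) *
    ∫ ω, ∑ t ∈ Finset.range T, stageCost Q R S (x t ω) (u t ω) ∂μ) atTop (𝓝 c)

/-- `K` is an optimal control gain of the infinite-horizon LQR problem: from every initial state,
the state feedback `u_t = -K x_t` attains the minimum of the average cost over all admissible
controls. -/
def IsOptimalGain (A : Matrix n n ℝ) (B : Matrix n m ℝ) (Q : Matrix n n ℝ) (R : Matrix m m ℝ)
    (S : Matrix m n ℝ) (μ : Measure Ω) (w : ℕ → Ω → n → ℝ) (K : Matrix m n ℝ) : Prop :=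
  ∀ x₀ : n → ℝ, ∃ (x : ℕ → Ω → n → ℝ) (u : ℕ → Ω → m → ℝ) (c : ℝ),
    IsAdmissible A B μ w x₀ x u ∧ (∀ t ω, u t ω = -(K *ᵥ x t ω)) ∧
    HasAverageCost Q R S μ x u c ∧
    ∀ (x' : ℕ → Ω → n → ℝ) (u' : ℕ → Ω → m → ℝ) (c' : ℝ),
      IsAdmissible A B μ w x₀ x' u' → HasAverageCost Q R S μ x' u' c' → c ≤ c'

end Control

end NetworkLQR

end

/-!
# Spatial decay of the optimal gain of a network LQR problem

The proof has a stochastic part, which identifies the optimal gain, and a deterministic part, which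
locates it as one entry of the solution of a linear system that is sparse in time and decaying in
space.

*The optimal gain solves the Riccati equation.* Let `P` be the cost matrix of `K`, the Lyapunov sum
`lyap (A - B K) (gainCost Q R S K)`. From the initial state `0` the average cost of `K` is `tr P`.
Let `K'` minimize the one-step problem with cost-to-go `P`. Completing the square and telescoping
along the powers of `A - B K'` bounds the average cost of `K'` by
`tr P - tr ((K - K')ᵀ M (K - K'))` with `M = R + BᵀPB` positive definite, so that optimality forces
`K = K'` (`riccati_of_isOptimalGain`). Stability of `A - B K'` is not needed.

*The optimality system.* By the Riccati equation, the trajectory `x_t = (A - B K)ᵗ x₀`,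
`u_t = -K x_t`, together with the multipliers `P x_{t+1}`, is a square-summable solution of the
first-order conditions of the infinite-horizon problem (`exists_optimal_trajectory`). These
conditions form a linear system with a symmetric operator `kkt` that couples adjacent times only and
whose coefficients are `A, B, Q, R, S` and their transposes. It is bounded above (`norm_kkt_le`; the
norm of `A` is controlled through `A - B K₀`) and below (`norm_le_kktInv_mul`): pairing the
equations with the unknowns leaves the stage cost, which is coercive, and the multipliers are
recovered from `λ_t = (A - B K₀)ᵀ λ_{t+1} + …`, where `A - B K₀` is stable.

*Interpolation.* Gradient descent on the squared residual, started at `0`, converges at a geometric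
rate `e^{-α}` that does not depend on the size of the network (`exists_represents_iter`). Each step
multiplies by the data a bounded number of times, so the `k`-th iterate decays in space with the
rate of the data and with a constant `Mᵏ` (`MatSeq.isSED_iter`). Hence
`‖[K]ᵢⱼ‖ ≤ C e^{-α k} + Mᵏ e^{-γ dist(i,j)}` for every `k`, and a number of steps proportional to
the distance gives the decay rate `γ α / (α + log M)` (`le_of_forall_le_exp_add_pow`). Only `log M`
involves the number of agents and the decay constants of the data, which is why these enter the rate
through logarithms; `1/α` is a polynomial in the remaining quantities.
-/

namespace NetworkLQR

/-! ### Quadratic forms and coercivity of the stage cost -/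

section Forms

variable {m n : Type*} [Fintype m] [Fintype n] [DecidableEq m] [DecidableEq n]

lemma dotProduct_self_eq_norm_sq {n : Type*} [Fintype n] (x : n → ℝ) :
    x ⬝ᵥ x = ‖WithLp.toLp 2 x‖ ^ 2 := by
  rw [EuclideanSpace.norm_sq_eq]
  simp [dotProduct, pow_two]

lemma zero_le_dotProduct_self {n : Type*} [Fintype n] (x : n → ℝ) : 0 ≤ x ⬝ᵥ x := by
  rw [dotProduct_self_eq_norm_sq]; positivity

lemma norm_toLp_mulVec_le {m n : Type*} [Fintype m] [Fintype n] [DecidableEq n]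
    (X : Matrix m n ℝ) (x : n → ℝ) :
    ‖WithLp.toLp 2 (X *ᵥ x)‖ ≤ ‖X‖ * ‖WithLp.toLp 2 x‖ := by
  simpa using Matrix.l2_opNorm_mulVec X (WithLp.toLp 2 x)

lemma mulVec_dotProduct_self_le {m n : Type*} [Fintype m] [Fintype n] [DecidableEq n]
    (X : Matrix m n ℝ) (x : n → ℝ) :
    (X *ᵥ x) ⬝ᵥ (X *ᵥ x) ≤ ‖X‖ ^ 2 * (x ⬝ᵥ x) := by
  rw [dotProduct_self_eq_norm_sq, dotProduct_self_eq_norm_sq, ← mul_pow]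
  gcongr
  exact norm_toLp_mulVec_le X x

lemma norm_transpose_eq (X : Matrix m n ℝ) : ‖Xᵀ‖ = ‖X‖ := by
  rw [← Matrix.conjTranspose_eq_transpose_of_trivial, Matrix.l2_opNorm_conjTranspose]

lemma dotProduct_transpose_mulVec {m n : Type*} [Fintype m] [Fintype n]
    (X : Matrix m n ℝ) (x : n → ℝ) (u : m → ℝ) :
    x ⬝ᵥ (Xᵀ *ᵥ u) = u ⬝ᵥ (X *ᵥ x) := by
  rw [Matrix.mulVec_transpose, dotProduct_comm, Matrix.dotProduct_mulVec]

lemma lamMin_pos [Nonempty n] {Q : Matrix n n ℝ} (hQ : Q.PosDef) : 0 < lamMin Q := by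
  have hs : spectrum ℝ Q = Set.range hQ.isHermitian.eigenvalues :=
    hQ.isHermitian.spectrum_real_eq_range_eigenvalues
  have hne : (Set.range hQ.isHermitian.eigenvalues).Nonempty := Set.range_nonempty _
  obtain ⟨i, hi⟩ := hne.csInf_mem (Set.finite_range _)
  rw [lamMin, hs, ← hi]
  exact hQ.eigenvalues_pos i

lemma lamMin_mul_dotProduct_le {Q : Matrix n n ℝ} (hQ : Q.IsHermitian) (x : n → ℝ) :
    lamMin Q * (x ⬝ᵥ x) ≤ x ⬝ᵥ (Q *ᵥ x) := by
  have hs : spectrum ℝ Q = Set.range hQ.eigenvalues := hQ.spectrum_real_eq_range_eigenvalues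
  have h : (Q - lamMin Q • (1 : Matrix n n ℝ)).PosSemidef := by
    have hh : (Q - lamMin Q • (1 : Matrix n n ℝ)).IsHermitian :=
      hQ.sub (by simp [Matrix.IsHermitian])
    rw [hh.posSemidef_iff_eigenvalues_nonneg]
    intro i
    have hi : hh.eigenvalues i ∈ spectrum ℝ (Q - lamMin Q • (1 : Matrix n n ℝ)) :=
      hh.spectrum_real_eq_range_eigenvalues ▸ ⟨i, rfl⟩
    change 0 ≤ hh.eigenvalues i
    generalize hh.eigenvalues i = e at hi ⊢
    rw [← Algebra.algebraMap_eq_smul_one, sub_eq_add_neg, ← map_neg, add_comm,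
      ← spectrum.vadd_eq, Set.mem_vadd_set] at hi
    obtain ⟨y, hy, hy'⟩ := hi
    have : lamMin Q ≤ y := csInf_le (by rw [hs]; exact (Set.finite_range _).bddBelow) hy
    simp only [vadd_eq_add] at hy'
    linarith
  have := h.dotProduct_mulVec_nonneg x
  simp only [star_trivial, Matrix.sub_mulVec, Matrix.smul_mulVec, Matrix.one_mulVec,
    dotProduct_sub, dotProduct_smul, smul_eq_mul] at this
  linarith

/-- `1/w`, where `w` is a lower bound for the smallest eigenvalue of the stage-cost matrix
`[[Q, Sᵀ], [S, R]]`; here `lS`, `lQ` stand for `1/λ_min` of the Schur complement and of `Q`. -/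
def formConst {A : Type*} [CommSemiring A] (lS lQ nS : A) : A :=
  2 * lQ + (2 * nS ^ 2 * lQ ^ 2 + 1) * lS

lemma stageCost_eq_square {m n : Type*} [Fintype m] [Fintype n] [DecidableEq n]
    {Q : Matrix n n ℝ} (R : Matrix m m ℝ) (S : Matrix m n ℝ)
    (hQ : Q.PosDef) (x : n → ℝ) (u : m → ℝ) :
    stageCost Q R S x u =
      (x + Q⁻¹ *ᵥ (Sᵀ *ᵥ u)) ⬝ᵥ (Q *ᵥ (x + Q⁻¹ *ᵥ (Sᵀ *ᵥ u))) +
        u ⬝ᵥ ((R - S * Q⁻¹ * Sᵀ) *ᵥ u) := by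
  have hu : IsUnit Q.det := (Matrix.isUnit_iff_isUnit_det Q).mp hQ.isUnit
  have hT : Qᵀ = Q := by
    rw [← Matrix.conjTranspose_eq_transpose_of_trivial]; exact hQ.isHermitian
  have h1 : Q *ᵥ (Q⁻¹ *ᵥ (Sᵀ *ᵥ u)) = Sᵀ *ᵥ u := by
    rw [Matrix.mulVec_mulVec, Matrix.mul_nonsing_inv _ hu, Matrix.one_mulVec]
  have h2 : (Q⁻¹ *ᵥ (Sᵀ *ᵥ u)) ⬝ᵥ (Q *ᵥ x) = u ⬝ᵥ (S *ᵥ x) := by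
    have := dotProduct_transpose_mulVec Q (Q⁻¹ *ᵥ (Sᵀ *ᵥ u)) x
    rw [hT, h1, dotProduct_transpose_mulVec] at this
    exact this
  have h3 : (Q⁻¹ *ᵥ (Sᵀ *ᵥ u)) ⬝ᵥ (Sᵀ *ᵥ u) = u ⬝ᵥ ((S * Q⁻¹ * Sᵀ) *ᵥ u) := by
    rw [dotProduct_transpose_mulVec, ← Matrix.mulVec_mulVec, ← Matrix.mulVec_mulVec]
  have h4 : x ⬝ᵥ (Sᵀ *ᵥ u) = u ⬝ᵥ (S *ᵥ x) := dotProduct_transpose_mulVec S x u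
  simp only [stageCost, Matrix.mulVec_add, dotProduct_add, add_dotProduct, Matrix.sub_mulVec,
    dotProduct_sub, h1, h2, h3, h4]
  ring

/-- Strict convexity of the stage cost: it dominates a multiple of `|x|² + |u|²`. -/
lemma dotProduct_add_le_stageCost [Nonempty m] [Nonempty n] {Q : Matrix n n ℝ} {R : Matrix m m ℝ}
    {S : Matrix m n ℝ} (hQ : Q.PosDef) (hR : (R - S * Q⁻¹ * Sᵀ).PosDef) (x : n → ℝ)
    (u : m → ℝ) :
    x ⬝ᵥ x + u ⬝ᵥ u ≤
      formConst (1 / lamMin (R - S * Q⁻¹ * Sᵀ)) (1 / lamMin Q) ‖S‖ * stageCost Q R S x u := by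
  set z := x + Q⁻¹ *ᵥ (Sᵀ *ᵥ u) with hz
  have hu : IsUnit Q.det := (Matrix.isUnit_iff_isUnit_det Q).mp hQ.isUnit
  have hl := lamMin_pos hQ
  have hl' := lamMin_pos hR
  have e := stageCost_eq_square R S hQ x u
  rw [← hz] at e
  have hzQ := lamMin_mul_dotProduct_le hQ.isHermitian z
  have huR := lamMin_mul_dotProduct_le hR.isHermitian u
  set E := stageCost Q R S x u
  set lQ := lamMin Q
  set lS := lamMin (R - S * Q⁻¹ * Sᵀ)
  have z0 := zero_le_dotProduct_self z
  have u0 := zero_le_dotProduct_self u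
  have hzE : z ⬝ᵥ z ≤ 1 / lQ * E := by
    rw [one_div, inv_mul_eq_div, le_div_iff₀ hl]; nlinarith
  have huE : u ⬝ᵥ u ≤ 1 / lS * E := by
    rw [one_div, inv_mul_eq_div, le_div_iff₀ hl']; nlinarith
  set y := Q⁻¹ *ᵥ (Sᵀ *ᵥ u) with hy
  have hQy : Q *ᵥ y = Sᵀ *ᵥ u := by
    rw [hy, Matrix.mulVec_mulVec, Matrix.mul_nonsing_inv _ hu, Matrix.one_mulVec]
  -- `|Q⁻¹ Sᵀ u| ≤ ‖S‖ |u| / λ_min(Q)`, by coercivity of `Q` and Cauchy–Schwarz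
  have hyn : ‖WithLp.toLp 2 y‖ ≤ 1 / lQ * (‖S‖ * ‖WithLp.toLp 2 u‖) := by
    have h1 := lamMin_mul_dotProduct_le hQ.isHermitian y
    rw [hQy, dotProduct_self_eq_norm_sq] at h1
    have h2 : y ⬝ᵥ (Sᵀ *ᵥ u) ≤ ‖WithLp.toLp 2 y‖ * ‖WithLp.toLp 2 (Sᵀ *ᵥ u)‖ := by
      have := real_inner_le_norm (WithLp.toLp 2 (Sᵀ *ᵥ u)) (WithLp.toLp 2 y)
      rw [EuclideanSpace.inner_toLp_toLp, star_trivial] at this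
      linarith [mul_comm ‖WithLp.toLp 2 y‖ ‖WithLp.toLp 2 (Sᵀ *ᵥ u)‖]
    have h3 := norm_toLp_mulVec_le Sᵀ u
    rw [norm_transpose_eq] at h3
    rw [one_div, inv_mul_eq_div, le_div_iff₀ hl]
    rcases (norm_nonneg (WithLp.toLp 2 y)).eq_or_lt with h | h
    · rw [← h, zero_mul]; positivity
    · have : ‖WithLp.toLp 2 y‖ * (‖WithLp.toLp 2 y‖ * lQ) ≤
        ‖WithLp.toLp 2 y‖ * (‖S‖ * ‖WithLp.toLp 2 u‖) := by
        nlinarith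
      exact le_of_mul_le_mul_left this h
  have hy2 : y ⬝ᵥ y ≤ (1 / lQ) ^ 2 * ‖S‖ ^ 2 * (u ⬝ᵥ u) := by
    rw [dotProduct_self_eq_norm_sq, dotProduct_self_eq_norm_sq]
    calc ‖WithLp.toLp 2 y‖ ^ 2 ≤ (1 / lQ * (‖S‖ * ‖WithLp.toLp 2 u‖)) ^ 2 := by gcongr
      _ = _ := by ring
  have hx : x ⬝ᵥ x ≤ 2 * (z ⬝ᵥ z) + 2 * (y ⬝ᵥ y) := by
    have : x = z - y := by rw [hz]; abel
    have h2 := zero_le_dotProduct_self (z + y)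
    rw [this]
    simp only [dotProduct_add, add_dotProduct, dotProduct_sub, sub_dotProduct] at h2 ⊢
    rw [dotProduct_comm y z] at *
    linarith
  have hfin : (2 * (1 / lQ) ^ 2 * ‖S‖ ^ 2 + 1) * (u ⬝ᵥ u) ≤
      (2 * (1 / lQ) ^ 2 * ‖S‖ ^ 2 + 1) * (1 / lS * E) := by gcongr
  unfold formConst
  linarith

end Forms

/-! ### Covariances and average cost of linear feedback -/

section Covariance

section Marginals

variable {n : Type*} [Fintype n] {Ω : Type*} [MeasurableSpace Ω] {μ : Measure Ω}
  {w : ℕ → Ω → n → ℝ}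

lemma integrable_mul_of_memLp_two {f g : Ω → ℝ} (hf : MemLp f 2 μ) (hg : MemLp g 2 μ) :
    Integrable (fun ω => f ω * g ω) μ :=
  hf.integrable_mul hg

lemma IsWhiteNoise.measurable_eval (hw : IsWhiteNoise μ w) (t : ℕ) (i : n) :
    Measurable fun ω => w t ω i :=
  (measurable_pi_apply i).comp (hw.measurable t)

lemma IsWhiteNoise.map_eval (hw : IsWhiteNoise μ w) (t : ℕ) (i : n) :
    μ.map (fun ω => w t ω i) = gaussianReal 0 1 := by
  have h := (measurePreserving_eval (fun _ : n => gaussianReal 0 1) i).map_eq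
  rw [← hw.law t, Measure.map_map (measurable_pi_apply i) (hw.measurable t)] at h
  exact h

lemma IsWhiteNoise.memLp (hw : IsWhiteNoise μ w) (t : ℕ) (i : n) :
    MemLp (fun ω => w t ω i) 2 μ :=
  (memLp_id_gaussianReal' (μ := 0) (v := 1) 2 (by simp)).comp_measurePreserving
    ⟨hw.measurable_eval t i, hw.map_eval t i⟩

lemma IsWhiteNoise.integral_eval (hw : IsWhiteNoise μ w) (t : ℕ) (i : n) :
    ∫ ω, w t ω i ∂μ = 0 := by
  have h := integral_map (μ := μ) (hw.measurable_eval t i).aemeasurable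
    (f := fun y : ℝ => y) (by fun_prop)
  rw [← h, hw.map_eval, integral_id_gaussianReal]

lemma IsWhiteNoise.integral_sq (hw : IsWhiteNoise μ w) (t : ℕ) (i : n) :
    ∫ ω, w t ω i * w t ω i ∂μ = 1 := by
  have h := integral_map (μ := μ) (hw.measurable_eval t i).aemeasurable
    (f := fun y : ℝ => y * y) (by fun_prop)
  rw [← h, hw.map_eval]
  have h4 := variance_eq_sub (memLp_id_gaussianReal' (μ := 0) (v := 1) 2 (by simp))
  simp only [variance_id_gaussianReal, Pi.pow_apply, id, integral_id_gaussianReal] at h4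
  simpa [pow_two] using h4.symm

lemma IsWhiteNoise.indepFun_eval (hw : IsWhiteNoise μ w) (t : ℕ) {i j : n} (hij : i ≠ j) :
    IndepFun (fun ω => w t ω i) (fun ω => w t ω j) μ := by
  have h0 : iIndepFun (fun (i : n) (v : n → ℝ) => v i)
      (Measure.pi (fun _ : n => gaussianReal 0 1)) :=
    iIndepFun_pi (X := fun _ => id) (fun _ => aemeasurable_id)
  have h1 := h0.indepFun hij
  rw [← hw.law t, indepFun_iff_measure_inter_preimage_eq_mul] at h1
  rw [indepFun_iff_measure_inter_preimage_eq_mul]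
  intro s r hs hr
  have hs' := measurable_pi_apply (X := fun _ : n => ℝ) i hs
  have hr' := measurable_pi_apply (X := fun _ : n => ℝ) j hr
  have h2 := h1 s r hs hr
  rwa [Measure.map_apply (hw.measurable t) (hs'.inter hr'),
    Measure.map_apply (hw.measurable t) hs', Measure.map_apply (hw.measurable t) hr'] at h2

end Marginals

variable {n m : Type*} [Fintype n] [Fintype m] [DecidableEq n]
  {Ω : Type*} [MeasurableSpace Ω] {μ : Measure Ω} {w : ℕ → Ω → n → ℝ}

lemma IsWhiteNoise.integral_mul (hw : IsWhiteNoise μ w) (s t : ℕ) (i j : n) :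
    ∫ ω, w s ω i * w t ω j ∂μ = if s = t then (1 : Matrix n n ℝ) i j else 0 := by
  have key : IndepFun (fun ω => w s ω i) (fun ω => w t ω j) μ →
      ∫ ω, w s ω i * w t ω j ∂μ = 0 := by
    intro h
    rw [h.integral_fun_mul_eq_mul_integral (hw.measurable_eval s i).aestronglyMeasurable
      (hw.measurable_eval t j).aestronglyMeasurable, hw.integral_eval, zero_mul]
  split_ifs with hst
  · subst hst
    by_cases hij : i = j
    · subst hij; rw [hw.integral_sq, Matrix.one_apply_eq]
    · rw [key (hw.indepFun_eval s hij), Matrix.one_apply_ne hij]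
  · exact key ((hw.indep.indepFun hst).comp (measurable_pi_apply i) (measurable_pi_apply j))

/-- The covariance at time `t` of the process `x_{k+1} = F x_k + w_k` started at `0` with noise of
identity covariance. -/
def gram (F : Matrix n n ℝ) (t : ℕ) : Matrix n n ℝ :=
  ∑ k ∈ Finset.range t, F ^ k * (F ^ k)ᵀ

lemma gram_succ (F : Matrix n n ℝ) (t : ℕ) : gram F (t + 1) = F * gram F t * Fᵀ + 1 := by
  simp only [gram, Finset.sum_range_succ', Matrix.mul_sum, Matrix.sum_mul]
  congr 1
  · refine Finset.sum_congr rfl fun k _ => ?_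
    rw [pow_succ', Matrix.transpose_mul]
    simp only [Matrix.mul_assoc]
  · simp

variable {F : Matrix n n ℝ} {x : ℕ → Ω → n → ℝ}

lemma memLp_linear_process {n : Type*} [Fintype n] {w : ℕ → Ω → n → ℝ} {F : Matrix n n ℝ}
    {x : ℕ → Ω → n → ℝ} (hw : IsWhiteNoise μ w) (h0 : ∀ ω, x 0 ω = 0)
    (hx : ∀ t ω, x (t + 1) ω = F *ᵥ x t ω + w t ω) (t : ℕ) (i : n) :
    MemLp (fun ω => x t ω i) 2 μ := by
  induction t generalizing i with
  | zero => simp [h0]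
  | succ t ih =>
    simp only [hx, Pi.add_apply, Matrix.mulVec, dotProduct]
    exact (memLp_finsetSum _ fun j _ => (ih j).const_mul (F i j)).add (hw.memLp t i)

/-- The state is uncorrelated with the noise still to come. -/
lemma integral_linear_process_mul_noise (hw : IsWhiteNoise μ w) (h0 : ∀ ω, x 0 ω = 0)
    (hx : ∀ t ω, x (t + 1) ω = F *ᵥ x t ω + w t ω) (t s : ℕ) (hts : t ≤ s) (i j : n) :
    ∫ ω, x t ω i * w s ω j ∂μ = 0 := by
  induction t generalizing i with
  | zero => simp [h0]
  | succ t ih =>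
    have hi : ∀ k, Integrable (fun ω => F i k * (x t ω k * w s ω j)) μ := fun k =>
      (integrable_mul_of_memLp_two (memLp_linear_process hw h0 hx t k) (hw.memLp s j)).const_mul _
    have e : ∀ ω, x (t + 1) ω i * w s ω j =
        (∑ k, F i k * (x t ω k * w s ω j)) + w t ω i * w s ω j := by
      intro ω
      simp only [hx, Pi.add_apply, Matrix.mulVec, dotProduct, add_mul, Finset.sum_mul, mul_assoc]
    simp only [e]
    rw [integral_add (f := fun ω => ∑ k, F i k * (x t ω k * w s ω j))
      (integrable_finsetSum _ fun k _ => hi k)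
      (integrable_mul_of_memLp_two (hw.memLp t i) (hw.memLp s j)),
      integral_finsetSum _ fun k _ => hi k,
      hw.integral_mul, if_neg (by omega), add_zero]
    refine Finset.sum_eq_zero fun k _ => ?_
    rw [integral_const_mul, ih (by omega), mul_zero]

lemma integral_linear_process_mul (hw : IsWhiteNoise μ w) (h0 : ∀ ω, x 0 ω = 0)
    (hx : ∀ t ω, x (t + 1) ω = F *ᵥ x t ω + w t ω) (t : ℕ) (i j : n) :
    ∫ ω, x t ω i * x t ω j ∂μ = gram F t i j := by
  induction t generalizing i j with
  | zero => simp [h0, gram]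
  | succ t ih =>
    have hM := memLp_linear_process hw h0 hx t
    have e : ∀ ω, x (t + 1) ω i * x (t + 1) ω j =
        ((∑ k, ∑ l, F i k * F j l * (x t ω k * x t ω l)) + w t ω i * w t ω j) +
          ((∑ k, F i k * (x t ω k * w t ω j)) + ∑ l, F j l * (x t ω l * w t ω i)) := by
      intro ω
      have e1 : ∑ k, ∑ l, F i k * F j l * (x t ω k * x t ω l) =
          (∑ k, F i k * x t ω k) * ∑ l, F j l * x t ω l := by
        rw [Finset.sum_mul_sum]
        exact Finset.sum_congr rfl fun k _ => Finset.sum_congr rfl fun l _ => by ring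
      have e2 : ∀ (a b : n), ∑ k, F a k * (x t ω k * w t ω b) =
          (∑ k, F a k * x t ω k) * w t ω b := fun a b => by
        rw [Finset.sum_mul]; exact Finset.sum_congr rfl fun k _ => by ring
      rw [e1, e2, e2]
      simp only [hx, Pi.add_apply, Matrix.mulVec, dotProduct]
      ring
    have i1 : ∀ k l, Integrable (fun ω => F i k * F j l * (x t ω k * x t ω l)) μ := fun k l =>
      (integrable_mul_of_memLp_two (hM k) (hM l)).const_mul _
    have i2 : ∀ a b k, Integrable (fun ω => F a k * (x t ω k * w t ω b)) μ := fun a b k =>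
      (integrable_mul_of_memLp_two (hM k) (hw.memLp t b)).const_mul _
    have i3 : ∀ k, Integrable (fun ω => ∑ l, F i k * F j l * (x t ω k * x t ω l)) μ := fun k =>
      integrable_finsetSum _ fun l _ => i1 k l
    simp only [e]
    have i4 : Integrable (fun ω => ∑ k, ∑ l, F i k * F j l * (x t ω k * x t ω l)) μ :=
      integrable_finsetSum _ fun k _ => i3 k
    have i5 := integrable_mul_of_memLp_two (hw.memLp t i) (hw.memLp t j)
    have i6 : ∀ a b, Integrable (fun ω => ∑ k, F a k * (x t ω k * w t ω b)) μ := fun a b =>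
      integrable_finsetSum _ fun k _ => i2 a b k
    rw [integral_add (f := fun ω => _ + _) (g := fun ω => _ + _) (i4.add i5)
      ((i6 i j).add (i6 j i)), integral_add i4 i5, integral_add (i6 i j) (i6 j i),
      integral_finsetSum _ fun k _ => i3 k, integral_finsetSum _ fun k _ => i2 i j k,
      integral_finsetSum _ fun k _ => i2 j i k, hw.integral_mul, if_pos rfl, gram_succ]
    have z : ∀ a b k, ∫ ω, F a k * (x t ω k * w t ω b) ∂μ = 0 := fun a b k => by
      rw [integral_const_mul, integral_linear_process_mul_noise hw h0 hx t t le_rfl, mul_zero]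
    simp only [z, Finset.sum_const_zero, add_zero, Matrix.add_apply, add_left_inj]
    simp only [integral_finsetSum _ fun l _ => i1 _ l, integral_const_mul, ih, Matrix.mul_apply,
      Matrix.transpose_apply, Finset.sum_mul]
    rw [Finset.sum_comm]
    exact Finset.sum_congr rfl fun k _ => Finset.sum_congr rfl fun l _ => by ring

/-- The stage cost of the feedback `u = -L x` is `xᵀ (gainCost Q R S L) x`. -/
def gainCost (Q : Matrix n n ℝ) (R : Matrix m m ℝ) (S : Matrix m n ℝ) (L : Matrix m n ℝ) :
    Matrix n n ℝ :=
  Q - Sᵀ * L - Lᵀ * S + Lᵀ * R * L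

lemma dotProduct_gainCost_mulVec {n : Type*} [Fintype n] (Q : Matrix n n ℝ)
    (R : Matrix m m ℝ) (S L : Matrix m n ℝ) (x : n → ℝ) :
    x ⬝ᵥ (gainCost Q R S L *ᵥ x) = stageCost Q R S x (-(L *ᵥ x)) := by
  have h1 : x ⬝ᵥ ((Sᵀ * L) *ᵥ x) = (L *ᵥ x) ⬝ᵥ (S *ᵥ x) := by
    rw [← Matrix.mulVec_mulVec, dotProduct_transpose_mulVec]
  have h2 : x ⬝ᵥ ((Lᵀ * S) *ᵥ x) = (L *ᵥ x) ⬝ᵥ (S *ᵥ x) := by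
    rw [← Matrix.mulVec_mulVec, dotProduct_transpose_mulVec, dotProduct_comm]
  have h3 : x ⬝ᵥ ((Lᵀ * R * L) *ᵥ x) = (L *ᵥ x) ⬝ᵥ (R *ᵥ (L *ᵥ x)) := by
    rw [Matrix.mul_assoc, ← Matrix.mulVec_mulVec, dotProduct_transpose_mulVec, dotProduct_comm,
      ← Matrix.mulVec_mulVec]
  simp only [gainCost, stageCost, Matrix.add_mulVec, Matrix.sub_mulVec, dotProduct_add,
    dotProduct_sub, h1, h2, h3, Matrix.mulVec_neg, neg_dotProduct, dotProduct_neg]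
  ring

lemma integral_dotProduct_mulVec (hw : IsWhiteNoise μ w) (h0 : ∀ ω, x 0 ω = 0)
    (hx : ∀ t ω, x (t + 1) ω = F *ᵥ x t ω + w t ω) (G : Matrix n n ℝ) (t : ℕ) :
    Integrable (fun ω => x t ω ⬝ᵥ (G *ᵥ x t ω)) μ ∧
      ∫ ω, x t ω ⬝ᵥ (G *ᵥ x t ω) ∂μ = (G * gram F t).trace := by
  have hM := memLp_linear_process hw h0 hx t
  have i1 : ∀ k l, Integrable (fun ω => G k l * (x t ω l * x t ω k)) μ := fun k l =>
      (integrable_mul_of_memLp_two (hM l) (hM k)).const_mul _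
  have i3 : ∀ k, Integrable (fun ω => ∑ l, G k l * (x t ω l * x t ω k)) μ := fun k =>
      integrable_finsetSum _ fun l _ => i1 k l
  have e : ∀ ω, x t ω ⬝ᵥ (G *ᵥ x t ω) = ∑ k, ∑ l, G k l * (x t ω l * x t ω k) := by
    intro ω
    simp only [dotProduct, Matrix.mulVec, Finset.mul_sum]
    exact Finset.sum_congr rfl fun k _ => Finset.sum_congr rfl fun l _ => by ring
  simp only [e]
  refine ⟨integrable_finsetSum _ fun k _ => i3 k, ?_⟩
  rw [integral_finsetSum _ fun k _ => i3 k]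
  simp only [integral_finsetSum _ fun l _ => i1 _ l, integral_const_mul,
    integral_linear_process_mul hw h0 hx, Matrix.trace, Matrix.diag, Matrix.mul_apply]

/-- The average cost of the feedback `u = -L x` from the initial state `0`, once the expected stage
costs converge. -/
lemma hasAverageCost_of_tendsto (hw : IsWhiteNoise μ w) {A : Matrix n n ℝ} {B : Matrix n m ℝ}
    {Q : Matrix n n ℝ} {R : Matrix m m ℝ} {S L : Matrix m n ℝ} {u : ℕ → Ω → m → ℝ}
    (hadm : IsAdmissible A B μ w 0 x u) (hu : ∀ t ω, u t ω = -(L *ᵥ x t ω)) {c : ℝ}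
    (hc : Tendsto (fun t => (gainCost Q R S L * gram (A - B * L) t).trace) atTop (𝓝 c)) :
    HasAverageCost Q R S μ x u c := by
  have hx : ∀ t ω, x (t + 1) ω = (A - B * L) *ᵥ x t ω + w t ω := by
    intro t ω
    rw [hadm.dyn, hu, Matrix.sub_mulVec, Matrix.mulVec_neg, ← Matrix.mulVec_mulVec]
    abel
  have hI := integral_dotProduct_mulVec hw hadm.init hx (gainCost Q R S L)
  have e : ∀ T : ℕ, ∫ ω, ∑ t ∈ Finset.range T, stageCost Q R S (x t ω) (u t ω) ∂μ =
      ∑ t ∈ Finset.range T, (gainCost Q R S L * gram (A - B * L) t).trace := by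
    intro T
    simp only [hu, ← dotProduct_gainCost_mulVec]
    rw [integral_finsetSum _ fun t _ => (hI t).1]
    exact Finset.sum_congr rfl fun t _ => (hI t).2
  simp only [HasAverageCost, e, one_div]
  exact hc.cesaro

/-- Every linear feedback gain is realized by an admissible pair. -/
lemma exists_isAdmissible_feedback {n : Type*} [Fintype n] {w : ℕ → Ω → n → ℝ}
    (hw : IsWhiteNoise μ w) (A : Matrix n n ℝ) (B : Matrix n m ℝ)
    (L : Matrix m n ℝ) :
    ∃ (x : ℕ → Ω → n → ℝ) (u : ℕ → Ω → m → ℝ),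
      IsAdmissible A B μ w 0 x u ∧ ∀ t ω, u t ω = -(L *ᵥ x t ω) := by
  let x : ℕ → Ω → n → ℝ := fun t => Nat.rec (fun _ => 0)
    (fun s y ω => (A - B * L) *ᵥ y ω + w s ω) t
  have h0 : ∀ ω, x 0 ω = 0 := fun ω => rfl
  have hx : ∀ t ω, x (t + 1) ω = (A - B * L) *ᵥ x t ω + w t ω := fun t ω => rfl
  refine ⟨x, fun t ω => -(L *ᵥ x t ω), ⟨h0, ?_, ?_, ?_⟩, fun _ _ => rfl⟩
  · intro t ω
    rw [hx, Matrix.sub_mulVec, Matrix.mulVec_neg, ← Matrix.mulVec_mulVec]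
    abel
  · have hc : ∀ t, ∃ g : (Fin t → n → ℝ) → n → ℝ, Measurable g ∧
        ∀ ω, x t ω = g (fun s => w s ω) := by
      intro t
      induction t with
      | zero => exact ⟨fun _ => 0, measurable_const, h0⟩
      | succ t ih =>
        obtain ⟨g, hg, hgx⟩ := ih
        refine ⟨fun v => (A - B * L) *ᵥ g (fun s => v s.castSucc) + v (Fin.last t), ?_, ?_⟩
        · have h1 : Measurable fun v : Fin (t + 1) → n → ℝ => g (fun s => v s.castSucc) :=
            hg.comp (measurable_pi_lambda _ fun s => measurable_pi_apply _)
          have h2 : Continuous fun y : n → ℝ => (A - B * L) *ᵥ y := by fun_prop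
          exact (h2.measurable.comp h1).add (measurable_pi_apply _)
        · intro ω
          simp [hx, hgx]
    intro t
    obtain ⟨g, hg, hgx⟩ := hc t
    have h2 : Continuous fun y : n → ℝ => -(L *ᵥ y) := by fun_prop
    exact ⟨fun v => -(L *ᵥ g v), h2.measurable.comp hg, fun ω => by rw [hgx]⟩
  · intro t
    refine MemLp.of_eval fun i => ?_
    simp only [Pi.neg_apply, Matrix.mulVec, dotProduct]
    exact (memLp_finsetSum _ fun j _ =>
      (memLp_linear_process hw h0 hx t j).const_mul (L i j)).neg

end Covariance

/-! ### Lyapunov sums, policy improvement and the Riccati equation -/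

section Lyapunov

variable {n : Type*} [Fintype n] [DecidableEq n]

/-- The solution `P = ∑ₖ (Fᵏ)ᵀ G Fᵏ` of the Lyapunov equation `P = G + Fᵀ P F`. -/
noncomputable def lyap (F G : Matrix n n ℝ) : Matrix n n ℝ :=
  ∑' k : ℕ, (F ^ k)ᵀ * G * F ^ k

lemma exp_neg_two_mul_lt_one {ρ : ℝ} (hρ : 0 < ρ) : Real.exp (-2 * ρ) < 1 :=
  Real.exp_zero ▸ Real.exp_lt_exp.mpr (by linarith)

lemma hasSum_exp_sq (τ : ℝ) {ρ : ℝ} (hρ : 0 < ρ) :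
    HasSum (fun k : ℕ => (τ * Real.exp (-ρ * k)) ^ 2) (τ ^ 2 * (1 / (1 - Real.exp (-2 * ρ)))) := by
  have h := (hasSum_geometric_of_lt_one (Real.exp_pos _).le (exp_neg_two_mul_lt_one hρ)).mul_left
    (τ ^ 2)
  rw [one_div]
  have e : (fun k : ℕ => (τ * Real.exp (-ρ * k)) ^ 2) =
      fun k => τ ^ 2 * Real.exp (-2 * ρ) ^ k := ?_
  · rw [e]; exact h
  funext k
  rw [mul_pow, ← Real.exp_nat_mul, ← Real.exp_nat_mul]
  congr 2
  push_cast
  ring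

lemma norm_lyap_term_le {F : Matrix n n ℝ} {τ ρ : ℝ} (hF : IsExpStable τ ρ F)
    (G : Matrix n n ℝ) (k : ℕ) :
    ‖(F ^ k)ᵀ * G * F ^ k‖ ≤ ‖G‖ * (τ * Real.exp (-ρ * k)) ^ 2 := by
  calc ‖(F ^ k)ᵀ * G * F ^ k‖ ≤ ‖(F ^ k)ᵀ‖ * ‖G‖ * ‖F ^ k‖ :=
        (Matrix.l2_opNorm_mul _ _).trans (by gcongr; exact Matrix.l2_opNorm_mul _ _)
    _ = ‖G‖ * ‖F ^ k‖ ^ 2 := by rw [norm_transpose_eq]; ring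
    _ ≤ _ := by gcongr; exact hF k

lemma summable_lyap {F : Matrix n n ℝ} {τ ρ : ℝ} (hρ : 0 < ρ) (hF : IsExpStable τ ρ F)
    (G : Matrix n n ℝ) : Summable fun k : ℕ => (F ^ k)ᵀ * G * F ^ k :=
  Summable.of_norm_bounded ((hasSum_exp_sq τ hρ).summable.mul_left ‖G‖)
    (norm_lyap_term_le hF G)

lemma norm_lyap_le {F : Matrix n n ℝ} {τ ρ : ℝ} (hρ : 0 < ρ) (hF : IsExpStable τ ρ F)
    (G : Matrix n n ℝ) : ‖lyap F G‖ ≤ τ ^ 2 * (1 / (1 - Real.exp (-2 * ρ))) * ‖G‖ := by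
  rw [mul_comm _ ‖G‖]
  exact tsum_of_norm_bounded ((hasSum_exp_sq τ hρ).mul_left ‖G‖) (norm_lyap_term_le hF G)

lemma lyap_eq {F : Matrix n n ℝ} {τ ρ : ℝ} (hρ : 0 < ρ) (hF : IsExpStable τ ρ F)
    (G : Matrix n n ℝ) : lyap F G = G + Fᵀ * lyap F G * F := by
  have hs := summable_lyap hρ hF G
  have h1 := hs.tsum_eq_zero_add
  simp only [pow_zero, Matrix.transpose_one, Matrix.one_mul, Matrix.mul_one] at h1
  have h2 : ∑' k : ℕ, Fᵀ * ((F ^ k)ᵀ * G * F ^ k) * F = Fᵀ * lyap F G * F :=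
    ((hs.hasSum.mul_left Fᵀ).mul_right F).tsum_eq
  rw [← h2, lyap, h1]
  congr 1
  refine (tsum_congr fun k => ?_)
  rw [pow_succ, Matrix.transpose_mul]
  simp only [Matrix.mul_assoc]

lemma lyap_transpose {F : Matrix n n ℝ} {τ ρ : ℝ} (hρ : 0 < ρ) (hF : IsExpStable τ ρ F)
    {G : Matrix n n ℝ} (hG : Gᵀ = G) : (lyap F G)ᵀ = lyap F G := by
  have h := (summable_lyap hρ hF G).hasSum
  have h' := h.matrix_transpose
  refine h'.unique ?_
  simpa [Matrix.transpose_mul, hG, Matrix.mul_assoc, lyap] using h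

lemma lyap_nonneg {F : Matrix n n ℝ} {τ ρ : ℝ} (hρ : 0 < ρ) (hF : IsExpStable τ ρ F)
    {G : Matrix n n ℝ} (hG : ∀ x, 0 ≤ x ⬝ᵥ (G *ᵥ x)) (x : n → ℝ) :
    0 ≤ x ⬝ᵥ (lyap F G *ᵥ x) := by
  let f : Matrix n n ℝ →+ ℝ :=
    { toFun := fun M => x ⬝ᵥ (M *ᵥ x)
      map_zero' := by simp
      map_add' := fun M N => by simp [Matrix.add_mulVec] }
  have hf : Continuous f := by
    change Continuous fun M : Matrix n n ℝ => x ⬝ᵥ (M *ᵥ x)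
    fun_prop
  refine ((summable_lyap hρ hF G).hasSum.map f hf).nonneg fun k => ?_
  change 0 ≤ x ⬝ᵥ (((F ^ k)ᵀ * G * F ^ k) *ᵥ x)
  rw [Matrix.mul_assoc, ← Matrix.mulVec_mulVec, dotProduct_transpose_mulVec, dotProduct_comm,
    ← Matrix.mulVec_mulVec]
  exact hG _

lemma tendsto_trace_mul_gram {F : Matrix n n ℝ} {τ ρ : ℝ} (hρ : 0 < ρ) (hF : IsExpStable τ ρ F)
    (G : Matrix n n ℝ) :
    Tendsto (fun t => (G * gram F t).trace) atTop (𝓝 (lyap F G).trace) := by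
  have h := ((summable_lyap hρ hF G).hasSum.map (Matrix.traceAddMonoidHom n ℝ)
    (by change Continuous fun M : Matrix n n ℝ => M.trace; fun_prop)).tendsto_sum_nat
  refine h.congr fun t => ?_
  rw [gram, Matrix.mul_sum, Matrix.trace_sum]
  refine Finset.sum_congr rfl fun k _ => ?_
  change ((F ^ k)ᵀ * G * F ^ k).trace = _
  rw [Matrix.mul_assoc, Matrix.trace_mul_comm, Matrix.mul_assoc]

lemma trace_mul_mul_transpose {n m : Type*} [Fintype n] [Fintype m]
    (G : Matrix n n ℝ) (H : Matrix n m ℝ) :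
    (G * (H * Hᵀ)).trace = ∑ i, H.col i ⬝ᵥ (G *ᵥ H.col i) := by
  rw [← Matrix.mul_assoc, Matrix.trace_mul_comm]
  simp only [Matrix.trace, Matrix.diag, Matrix.mul_apply, Matrix.transpose_apply, dotProduct,
    Matrix.mulVec, Matrix.col_apply]

lemma trace_mul_mul_transpose_nonneg {n m : Type*} [Fintype n] [Fintype m] {G : Matrix n n ℝ}
    (hG : ∀ x, 0 ≤ x ⬝ᵥ (G *ᵥ x)) (H : Matrix n m ℝ) : 0 ≤ (G * (H * Hᵀ)).trace := by
  rw [trace_mul_mul_transpose]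
  exact Finset.sum_nonneg fun i _ => hG _

end Lyapunov

section Riccati

variable {m n : Type*} [Fintype m] [Fintype n] [DecidableEq n]

lemma transpose_eq_of_posDef {n : Type*} {Q : Matrix n n ℝ} (hQ : Q.PosDef) : Qᵀ = Q := by
  rw [← Matrix.conjTranspose_eq_transpose_of_trivial]; exact hQ.isHermitian

lemma transpose_eq_of_schur {m : Type*} {Q : Matrix n n ℝ} {R : Matrix m m ℝ} {S : Matrix m n ℝ}
    (hQ : Q.PosDef) (hR : (R - S * Q⁻¹ * Sᵀ).PosDef) : Rᵀ = R := by
  have h := transpose_eq_of_posDef hR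
  rw [Matrix.transpose_sub, Matrix.transpose_mul, Matrix.transpose_mul, Matrix.transpose_transpose,
    Matrix.transpose_nonsing_inv, transpose_eq_of_posDef hQ, ← Matrix.mul_assoc] at h
  simpa using h

lemma stageCost_nonneg {Q : Matrix n n ℝ} {R : Matrix m m ℝ} {S : Matrix m n ℝ}
    (hQ : Q.PosDef) (hR : (R - S * Q⁻¹ * Sᵀ).PosDef) (x : n → ℝ) (u : m → ℝ) :
    0 ≤ stageCost Q R S x u := by
  rw [stageCost_eq_square R S hQ]
  have h1 := hQ.posSemidef.dotProduct_mulVec_nonneg (x + Q⁻¹ *ᵥ (Sᵀ *ᵥ u))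
  have h2 := hR.posSemidef.dotProduct_mulVec_nonneg u
  simp only [star_trivial] at h1 h2
  exact add_nonneg h1 h2

lemma dotProduct_mulVec_pos_of_schur {Q : Matrix n n ℝ} {R : Matrix m m ℝ} {S : Matrix m n ℝ}
    (hQ : Q.PosDef) (hR : (R - S * Q⁻¹ * Sᵀ).PosDef) {u : m → ℝ} (hu : u ≠ 0) :
    0 < u ⬝ᵥ (R *ᵥ u) := by
  have h := stageCost_eq_square R S hQ 0 u
  have h1 := hQ.posSemidef.dotProduct_mulVec_nonneg (0 + Q⁻¹ *ᵥ (Sᵀ *ᵥ u))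
  have h2 := hR.dotProduct_mulVec_pos hu
  simp only [star_trivial] at h1 h2
  simp only [stageCost, Matrix.mulVec_zero, dotProduct_zero, mul_zero] at h
  linarith

/-- Completing the square: `M = R + BᵀPB` and `K'` is the minimizing gain of the one-step problem
with cost-to-go `P`. -/
lemma gainCost_add_eq {n : Type*} [Fintype n] {A : Matrix n n ℝ} {B : Matrix n m ℝ}
    (Q : Matrix n n ℝ) {R : Matrix m m ℝ}
    {S : Matrix m n ℝ} {P : Matrix n n ℝ} (hP : Pᵀ = P) (hR : Rᵀ = R) {K' : Matrix m n ℝ}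
    (hK' : (R + Bᵀ * P * B) * K' = Bᵀ * P * A + S) (L : Matrix m n ℝ) :
    gainCost Q R S L + (A - B * L)ᵀ * P * (A - B * L) =
      gainCost Q R S K' + (A - B * K')ᵀ * P * (A - B * K') +
        (L - K')ᵀ * (R + Bᵀ * P * B) * (L - K') := by
  have hS : S = (R + Bᵀ * P * B) * K' - Bᵀ * P * A := by rw [hK']; abel
  have hST : Sᵀ = K'ᵀ * (R + Bᵀ * P * B) - Aᵀ * P * B := by
    rw [hS]
    simp only [Matrix.transpose_sub, Matrix.transpose_mul, Matrix.transpose_add, hP, hR,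
      Matrix.transpose_transpose, Matrix.mul_assoc]
  rw [gainCost, gainCost, hST, hS]
  simp only [Matrix.transpose_sub, Matrix.transpose_mul, Matrix.sub_mul, Matrix.mul_sub,
    Matrix.mul_add, Matrix.add_mul, Matrix.mul_assoc]
  abel

lemma gainCost_transpose {n : Type*} {Q : Matrix n n ℝ} {R : Matrix m m ℝ} (S L : Matrix m n ℝ)
    (hQ : Qᵀ = Q) (hR : Rᵀ = R) : (gainCost Q R S L)ᵀ = gainCost Q R S L := by
  simp only [gainCost, Matrix.transpose_sub, Matrix.transpose_add, Matrix.transpose_mul,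
    Matrix.transpose_transpose, hQ, hR, Matrix.mul_assoc]
  abel

/-- An optimal stabilizing gain solves the Riccati equation. One step of policy improvement turns
`K` into the minimizer `K'` of the one-step problem whose cost-to-go is the cost `P` of `K`; the
average cost of `K'` is at most `tr P - tr ((K - K')ᵀ M (K - K'))`, because the noise, of identity
covariance, excites every direction. Optimality of `K` therefore forces `K = K'`. -/
theorem riccati_of_isOptimalGain [DecidableEq m] {A : Matrix n n ℝ} {B : Matrix n m ℝ}
    {Q : Matrix n n ℝ}
    {R : Matrix m m ℝ} {S : Matrix m n ℝ} (hQ : Q.PosDef) (hR : (R - S * Q⁻¹ * Sᵀ).PosDef)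
    {τ ρ : ℝ} (hρ : 0 < ρ) {Ω : Type*} [MeasurableSpace Ω] {μ : Measure Ω} {w : ℕ → Ω → n → ℝ}
    (hw : IsWhiteNoise μ w) {K : Matrix m n ℝ} (hK : IsOptimalGain A B Q R S μ w K)
    (hstab : IsExpStable τ ρ (A - B * K)) :
    (R + Bᵀ * lyap (A - B * K) (gainCost Q R S K) * B) * K =
      Bᵀ * lyap (A - B * K) (gainCost Q R S K) * A + S := by
  set P := lyap (A - B * K) (gainCost Q R S K) with hPdef
  have hRT := transpose_eq_of_schur hQ hR
  have hcost : ∀ (L : Matrix m n ℝ) x, 0 ≤ x ⬝ᵥ (gainCost Q R S L *ᵥ x) := fun L x => by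
    rw [dotProduct_gainCost_mulVec]; exact stageCost_nonneg hQ hR _ _
  have hP : Pᵀ = P := lyap_transpose hρ hstab
    (gainCost_transpose S K (transpose_eq_of_posDef hQ) hRT)
  have hP0 : ∀ x, 0 ≤ x ⬝ᵥ (P *ᵥ x) := lyap_nonneg hρ hstab (hcost K)
  set M := R + Bᵀ * P * B with hM
  have hMpos : ∀ u, u ≠ 0 → 0 < u ⬝ᵥ (M *ᵥ u) := by
    intro u hu
    have h1 := dotProduct_mulVec_pos_of_schur hQ hR hu
    have h2 := hP0 (B *ᵥ u)
    rw [hM, Matrix.add_mulVec, dotProduct_add, Matrix.mul_assoc, ← Matrix.mulVec_mulVec,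
      dotProduct_transpose_mulVec, dotProduct_comm _ (B *ᵥ u), ← Matrix.mulVec_mulVec]
    linarith
  have hMT : Mᵀ = M := by
    simp only [hM, Matrix.transpose_add, Matrix.transpose_mul, hP, hRT, Matrix.transpose_transpose,
      Matrix.mul_assoc]
  have hMpd : M.PosDef := Matrix.PosDef.of_dotProduct_mulVec_pos
    (by rw [Matrix.IsHermitian, Matrix.conjTranspose_eq_transpose_of_trivial, hMT])
    (fun u hu => by simpa using hMpos u hu)
  have hMdet : IsUnit M.det := (Matrix.isUnit_iff_isUnit_det M).mp hMpd.isUnit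
  set K' := M⁻¹ * (Bᵀ * P * A + S) with hK'
  have hMK' : M * K' = Bᵀ * P * A + S := by
    rw [hK', ← Matrix.mul_assoc, Matrix.mul_nonsing_inv _ hMdet, Matrix.one_mul]
  set F := A - B * K' with hFdef
  set D := (K - K')ᵀ * M * (K - K') with hD
  have hD0 : ∀ x, 0 ≤ x ⬝ᵥ (D *ᵥ x) := by
    intro x
    rw [hD, Matrix.mul_assoc, ← Matrix.mulVec_mulVec, dotProduct_transpose_mulVec, dotProduct_comm,
      ← Matrix.mulVec_mulVec]
    by_cases h : (K - K') *ᵥ x = 0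
    · simp [h]
    · exact (hMpos _ h).le
  have hPeq : P = gainCost Q R S K' + Fᵀ * P * F + D := by
    rw [← gainCost_add_eq Q hP hRT hMK' K]
    exact lyap_eq hρ hstab _
  -- along the powers of `F`, the cost of `K'` telescopes against `P`
  have htel : ∀ t, (gainCost Q R S K' * gram F t).trace + (P * (F ^ t * (F ^ t)ᵀ)).trace +
      (D * gram F t).trace = P.trace := by
    intro t
    induction t with
    | zero => simp [gram]
    | succ t ih =>
      have h1 : (P * (F ^ t * (F ^ t)ᵀ)).trace =
          (gainCost Q R S K' * (F ^ t * (F ^ t)ᵀ)).trace +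
            (P * (F ^ (t + 1) * (F ^ (t + 1))ᵀ)).trace + (D * (F ^ t * (F ^ t)ᵀ)).trace := by
        have h2 : (P * (F ^ (t + 1) * (F ^ (t + 1))ᵀ)).trace =
            (Fᵀ * P * F * (F ^ t * (F ^ t)ᵀ)).trace := by
          rw [pow_succ', Matrix.transpose_mul,
            show P * (F * F ^ t * ((F ^ t)ᵀ * Fᵀ)) = P * F * (F ^ t * (F ^ t)ᵀ) * Fᵀ by
              simp only [Matrix.mul_assoc], Matrix.trace_mul_comm]
          simp only [Matrix.mul_assoc]
        rw [h2, ← Matrix.trace_add, ← Matrix.trace_add, ← Matrix.add_mul, ← Matrix.add_mul,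
          ← hPeq]
      have h3 : gram F (t + 1) = gram F t + F ^ t * (F ^ t)ᵀ := by
        rw [gram, Finset.sum_range_succ, ← gram]
      rw [h3, Matrix.mul_add, Matrix.mul_add, Matrix.trace_add, Matrix.trace_add]
      linarith
  have hsum : ∀ (G : Matrix n n ℝ) t, (G * gram F t).trace =
      ∑ k ∈ Finset.range t, (G * (F ^ k * (F ^ k)ᵀ)).trace := fun G t => by
    rw [gram, Matrix.mul_sum, Matrix.trace_sum]
  have hbound : ∀ t, (gainCost Q R S K' * gram F (t + 1)).trace ≤ P.trace - D.trace := by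
    intro t
    have h1 := htel (t + 1)
    have h2 := trace_mul_mul_transpose_nonneg hP0 (F ^ (t + 1))
    have h3 : D.trace ≤ (D * gram F (t + 1)).trace := by
      rw [hsum, Finset.sum_range_succ']
      have := Finset.sum_nonneg (s := Finset.range t)
        fun k _ => trace_mul_mul_transpose_nonneg hD0 (F ^ (k + 1))
      simpa using this
    linarith
  have hmono : Monotone fun t => (gainCost Q R S K' * gram F t).trace := by
    refine monotone_nat_of_le_succ fun t => ?_
    simp only [hsum]
    rw [Finset.sum_range_succ]
    have := trace_mul_mul_transpose_nonneg (hcost K') (F ^ t)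
    linarith
  have hbdd : BddAbove (Set.range fun t => (gainCost Q R S K' * gram F t).trace) :=
    ⟨P.trace - D.trace, by
      rintro _ ⟨t, rfl⟩
      exact (hmono (Nat.le_succ t)).trans (hbound t)⟩
  have hlim := tendsto_atTop_ciSup hmono hbdd
  have hc' : (⨆ t, (gainCost Q R S K' * gram F t).trace) ≤ P.trace - D.trace :=
    ciSup_le fun t => (hmono (Nat.le_succ t)).trans (hbound t)
  obtain ⟨x, u, c, hadm, hu, hc, hopt⟩ := hK 0
  have hcP : c = P.trace := tendsto_nhds_unique hc
    (hasAverageCost_of_tendsto hw hadm hu (tendsto_trace_mul_gram hρ hstab _))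
  obtain ⟨x', u', hadm', hu'⟩ := exists_isAdmissible_feedback hw A B K'
  have hle := hopt x' u' _ hadm' (hasAverageCost_of_tendsto hw hadm' hu' hlim)
  have hDtr : D.trace ≤ 0 := by linarith
  have hKK' : K - K' = 0 := by
    have h1 : D.trace = ∑ i, (K - K').col i ⬝ᵥ (M *ᵥ (K - K').col i) := by
      rw [← trace_mul_mul_transpose, hD, Matrix.mul_assoc, Matrix.trace_mul_comm, Matrix.mul_assoc]
    have hnn : ∀ i, 0 ≤ (K - K').col i ⬝ᵥ (M *ᵥ (K - K').col i) := fun i => by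
      by_cases h : (K - K').col i = 0
      · simp [h]
      · exact (hMpos _ h).le
    ext j i
    have h2 : (K - K').col i ⬝ᵥ (M *ᵥ (K - K').col i) ≤ 0 :=
      (Finset.single_le_sum (fun i _ => hnn i) (Finset.mem_univ i)).trans (h1 ▸ hDtr)
    have h3 : (K - K').col i = 0 := by
      by_contra h
      exact absurd (hMpos _ h) (not_lt.mpr h2)
    exact congrFun h3 j
  rw [sub_eq_zero.mp hKK', hMK']

end Riccati

/-! ### Square-summable sequences and gradient descent -/

open scoped RealInnerProductSpace

section Sequences

/-- Square-summable sequences, indexed by time, of vectors with entries indexed by `n`. -/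
abbrev SeqSpace (n : Type*) [Fintype n] : Type _ := lp (fun _ : ℕ => EuclideanSpace ℝ n) 2

namespace SeqSpace

variable {n : Type*} [Fintype n]

/-- The value of a sequence at time `t`, as a plain vector. -/
def coord (y : SeqSpace n) (t : ℕ) : n → ℝ := WithLp.ofLp (y t)

/-- The element of `SeqSpace` with given values. -/
noncomputable def mk (f : ℕ → n → ℝ) (h : Summable fun t => f t ⬝ᵥ f t) : SeqSpace n :=
  ⟨fun t => WithLp.toLp 2 (f t),
    memℓp_gen (by simpa [dotProduct_self_eq_norm_sq] using h)⟩

@[simp] lemma coord_mk (f : ℕ → n → ℝ) (h : Summable fun t => f t ⬝ᵥ f t) (t : ℕ) :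
    coord (mk f h) t = f t := rfl

@[simp] lemma coord_add (y z : SeqSpace n) (t : ℕ) : coord (y + z) t = coord y t + coord z t := rfl
@[simp] lemma coord_sub (y z : SeqSpace n) (t : ℕ) : coord (y - z) t = coord y t - coord z t := rfl
@[simp] lemma coord_zero (t : ℕ) : coord (0 : SeqSpace n) t = 0 := rfl
@[simp] lemma coord_smul (c : ℝ) (y : SeqSpace n) (t : ℕ) : coord (c • y) t = c • coord y t := rfl

lemma ext_coord {y z : SeqSpace n} (h : ∀ t, coord y t = coord z t) : y = z :=
  lp.ext (funext fun t => WithLp.ofLp_injective 2 (h t))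

lemma hasSum_inner_coord (y z : SeqSpace n) : HasSum (fun t => coord y t ⬝ᵥ coord z t) ⟪y, z⟫ := by
  have e : (fun t => coord y t ⬝ᵥ coord z t) = fun t => ⟪y t, z t⟫ := funext fun t => by
    rw [EuclideanSpace.inner_eq_star_dotProduct, star_trivial, dotProduct_comm]
    rfl
  rw [e]
  exact lp.hasSum_inner (𝕜 := ℝ) y z

lemma hasSum_norm_sq (y : SeqSpace n) : HasSum (fun t => coord y t ⬝ᵥ coord y t) (‖y‖ ^ 2) := by
  rw [← real_inner_self_eq_norm_sq]
  exact hasSum_inner_coord y y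

lemma coord_dotProduct_self_le (y : SeqSpace n) (t : ℕ) : coord y t ⬝ᵥ coord y t ≤ ‖y‖ ^ 2 :=
  le_hasSum y.hasSum_norm_sq t fun _ _ => zero_le_dotProduct_self _

end SeqSpace

open SeqSpace

variable {l m n : Type*} [Fintype l] [Fintype m] [Fintype n]

/-- The left shift on sequences. -/
noncomputable def shiftL : SeqSpace n →ₗ[ℝ] SeqSpace n where
  toFun y := SeqSpace.mk (fun t => coord y (t + 1))
    ((summable_nat_add_iff (f := fun t => coord y t ⬝ᵥ coord y t) 1).mpr y.hasSum_norm_sq.summable)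
  map_add' _ _ := ext_coord fun _ => rfl
  map_smul' _ _ := ext_coord fun _ => rfl

/-- The sequence `0, f 0, f 1, …`. -/
def rightShift {α : Type*} [Zero α] (f : ℕ → α) : ℕ → α
  | 0 => 0
  | t + 1 => f t

/-- The right shift on sequences, which puts a zero at time `0`. -/
noncomputable def shiftR : SeqSpace n →ₗ[ℝ] SeqSpace n where
  toFun y := SeqSpace.mk (rightShift (coord y)) ((summable_nat_add_iff
    (f := fun t => rightShift (coord y) t ⬝ᵥ rightShift (coord y) t) 1).mp
      y.hasSum_norm_sq.summable)
  map_add' y z := ext_coord fun t => by cases t <;> simp [rightShift]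
  map_smul' c y := ext_coord fun t => by cases t <;> simp [rightShift]

variable (y : SeqSpace n)

@[simp] lemma coord_shiftL (t : ℕ) : coord (shiftL y) t = coord y (t + 1) := rfl
@[simp] lemma coord_shiftR_zero : coord (shiftR y) 0 = 0 := rfl
@[simp] lemma coord_shiftR_succ (t : ℕ) : coord (shiftR y) (t + 1) = coord y t := rfl

lemma inner_shiftL (z : SeqSpace n) : ⟪shiftL y, z⟫ = ⟪y, shiftR z⟫ := by
  have h := hasSum_inner_coord y (shiftR z)
  rw [← hasSum_nat_add_iff' 1] at h
  have := h.unique (hasSum_inner_coord (shiftL y) z)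
  simpa using this.symm

lemma shiftL_shiftR : shiftL (shiftR y) = y := ext_coord fun _ => rfl

lemma norm_shiftR : ‖shiftR y‖ = ‖y‖ := by
  have h : ‖shiftR y‖ ^ 2 = ‖y‖ ^ 2 := by
    rw [← real_inner_self_eq_norm_sq, ← inner_shiftL, shiftL_shiftR, real_inner_self_eq_norm_sq]
  exact (pow_left_inj₀ (norm_nonneg _) (norm_nonneg _) two_ne_zero).mp h

lemma norm_shiftL_le : ‖shiftL y‖ ≤ ‖y‖ := by
  have h := real_inner_le_norm y (shiftR (shiftL y))
  rw [← inner_shiftL, real_inner_self_eq_norm_sq, norm_shiftR] at h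
  nlinarith [norm_nonneg (shiftL y), norm_nonneg y]

lemma norm_shiftL_pow_le (k : ℕ) : ‖(shiftL ^ k) y‖ ≤ ‖y‖ := by
  induction k with
  | zero => simp
  | succ k ih =>
    rw [pow_succ']
    exact (norm_shiftL_le _).trans ih

variable [DecidableEq n]

/-- A matrix acting on sequences, at each time. -/
noncomputable def mulSeq (X : Matrix m n ℝ) : SeqSpace n →ₗ[ℝ] SeqSpace m where
  toFun y := SeqSpace.mk (fun t => X *ᵥ coord y t)
    (Summable.of_nonneg_of_le (fun _ => zero_le_dotProduct_self _)
      (fun t => mulVec_dotProduct_self_le X (coord y t))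
      (y.hasSum_norm_sq.summable.mul_left (‖X‖ ^ 2)))
  map_add' y z := ext_coord fun t => by simp [Matrix.mulVec_add]
  map_smul' c y := ext_coord fun t => by simp [Matrix.mulVec_smul]

@[simp] lemma coord_mulSeq (X : Matrix m n ℝ) (y : SeqSpace n) (t : ℕ) :
    coord (mulSeq X y) t = X *ᵥ coord y t := rfl

lemma norm_mulSeq_le (X : Matrix m n ℝ) (y : SeqSpace n) : ‖mulSeq X y‖ ≤ ‖X‖ * ‖y‖ := by
  refine le_of_sq_le_sq ?_ (by positivity)
  rw [mul_pow]
  exact hasSum_le (fun t => mulVec_dotProduct_self_le X (coord y t)) (mulSeq X y).hasSum_norm_sq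
    (y.hasSum_norm_sq.mul_left _)

lemma mulSeq_mulSeq [DecidableEq m] (X : Matrix l m ℝ) (Y : Matrix m n ℝ) :
    mulSeq X (mulSeq Y y) = mulSeq (X * Y) y :=
  ext_coord fun t => by simp [Matrix.mulVec_mulVec]

lemma mulSeq_one : mulSeq (1 : Matrix n n ℝ) y = y :=
  ext_coord fun t => by simp

lemma mulSeq_sub (X Y : Matrix m n ℝ) : mulSeq (X - Y) y = mulSeq X y - mulSeq Y y :=
  ext_coord fun t => by simp [Matrix.sub_mulVec]

lemma inner_mulSeq [DecidableEq m] (X : Matrix m n ℝ) (z : SeqSpace m) :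
    ⟪mulSeq X y, z⟫ = ⟪y, mulSeq Xᵀ z⟫ := by
  refine (hasSum_inner_coord _ _).unique ?_
  have e : (fun t => coord (mulSeq X y) t ⬝ᵥ coord z t) =
      fun t => coord y t ⬝ᵥ coord (mulSeq Xᵀ z) t := funext fun t => by
    rw [coord_mulSeq, coord_mulSeq, dotProduct_transpose_mulVec, dotProduct_comm]
  rw [e]
  exact hasSum_inner_coord y (mulSeq Xᵀ z)

lemma shiftL_mulSeq (X : Matrix m n ℝ) : shiftL (mulSeq X y) = mulSeq X (shiftL y) := rfl

lemma shiftR_mulSeq (X : Matrix m n ℝ) : shiftR (mulSeq X y) = mulSeq X (shiftR y) :=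
  ext_coord fun t => by cases t <;> simp

/-- Inverting `1 - Fᵀ σ`, with `σ` the left shift, costs at most a factor `τ / (1 - e^{-ρ})`. -/
lemma norm_le_of_mulSeq_shiftL_sub {F : Matrix n n ℝ} {τ ρ Θ : ℝ} (hρ : 0 < ρ)
    (hF : IsExpStable τ ρ F) (hΘ : τ / (1 - Real.exp (-ρ)) ≤ Θ) {h : SeqSpace n}
    (hy : mulSeq Fᵀ (shiftL y) - y = h) : ‖y‖ ≤ Θ * ‖h‖ := by
  have hG : ∀ (k : ℕ) (z : SeqSpace n),
      ((mulSeq Fᵀ ∘ₗ shiftL) ^ k) z = mulSeq (Fᵀ ^ k) ((shiftL ^ k) z) := by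
    intro k
    induction k with
    | zero => intro z; simp [mulSeq_one]
    | succ k ih =>
      intro z
      rw [pow_succ', Module.End.mul_apply, ih, LinearMap.comp_apply, shiftL_mulSeq, mulSeq_mulSeq,
        pow_succ', pow_succ', Module.End.mul_apply]
  set G := mulSeq Fᵀ ∘ₗ shiftL with hGdef
  have hGn : ∀ (k : ℕ) (z : SeqSpace n), ‖(G ^ k) z‖ ≤ τ * Real.exp (-ρ * k) * ‖z‖ := by
    intro k z
    rw [hG, ← Matrix.transpose_pow]
    refine (norm_mulSeq_le _ _).trans ?_
    rw [norm_transpose_eq]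
    have := hF k
    have h2 := norm_shiftL_pow_le z k
    calc _ ≤ ‖F ^ k‖ * ‖z‖ := by gcongr
      _ ≤ _ := by gcongr
  have hyG : G y - y = h := hy
  have hexp : Real.exp (-ρ) < 1 := Real.exp_zero ▸ Real.exp_lt_exp.mpr (by linarith)
  have hgeo : HasSum (fun k : ℕ => τ * Real.exp (-ρ * k)) (τ / (1 - Real.exp (-ρ))) := by
    have := (hasSum_geometric_of_lt_one (Real.exp_pos (-ρ)).le hexp).mul_left τ
    rw [div_eq_mul_inv]
    have e : (fun k : ℕ => τ * Real.exp (-ρ * k)) = fun k => τ * Real.exp (-ρ) ^ k := by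
      funext k
      rw [← Real.exp_nat_mul, mul_comm (k : ℝ)]
    rw [e]; exact this
  have hτ : 0 ≤ τ := by
    have := (norm_nonneg _).trans (hF 0)
    simpa using this
  have hiter : ∀ N : ℕ, ‖y‖ ≤ τ * Real.exp (-ρ * N) * ‖y‖ +
      (∑ k ∈ Finset.range N, τ * Real.exp (-ρ * k)) * ‖h‖ := by
    intro N
    have e : y = (G ^ N) y - ∑ k ∈ Finset.range N, (G ^ k) h := by
      induction N with
      | zero => simp
      | succ N ih =>
        rw [Finset.sum_range_succ, pow_succ, Module.End.mul_apply,
          show G y = y + h by rw [← hyG]; abel, map_add]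
        rw [sub_eq_iff_eq_add.mp ih.symm]
        abel
    calc ‖y‖ = ‖(G ^ N) y - ∑ k ∈ Finset.range N, (G ^ k) h‖ := by rw [← e]
      _ ≤ ‖(G ^ N) y‖ + ∑ k ∈ Finset.range N, ‖(G ^ k) h‖ :=
        (norm_sub_le _ _).trans (by gcongr; exact norm_sum_le _ _)
      _ ≤ _ := by
        rw [Finset.sum_mul]
        exact add_le_add (hGn _ _) (Finset.sum_le_sum fun k _ => hGn k h)
  have hlim : Tendsto (fun N : ℕ => τ * Real.exp (-ρ * N) * ‖y‖ +
      (∑ k ∈ Finset.range N, τ * Real.exp (-ρ * k)) * ‖h‖) atTop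
      (𝓝 (0 * ‖y‖ + τ / (1 - Real.exp (-ρ)) * ‖h‖)) :=
    (hgeo.summable.tendsto_atTop_zero.mul_const _).add (hgeo.tendsto_sum_nat.mul_const _)
  have := ge_of_tendsto' hlim hiter
  rw [zero_mul, zero_add] at this
  exact this.trans (mul_le_mul_of_nonneg_right hΘ (norm_nonneg _))

end Sequences

section Contraction

variable {H : Type*} [NormedAddCommGroup H] [InnerProductSpace ℝ H]

/-- One step of gradient descent on `‖T x‖²`, for a symmetric operator `T` that is bounded by `L`
and bounded below by `1/κ`, is a contraction. -/
lemma norm_gradient_step_le (T : H →ₗ[ℝ] H) (hsymm : ∀ x y, ⟪T x, y⟫ = ⟪x, T y⟫) {L κ : ℝ}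
    (hL : 0 < L) (hTL : ∀ x, ‖T x‖ ≤ L * ‖x‖) (hκ : 0 < κ) (hTκ : ∀ x, ‖x‖ ≤ κ * ‖T x‖) (x : H) :
    ‖x - (1 / L ^ 2) • T (T x)‖ ≤ Real.exp (-(1 / (2 * κ ^ 2 * L ^ 2))) * ‖x‖ := by
  refine le_of_sq_le_sq ?_ (by positivity)
  have h1 : ‖x - (1 / L ^ 2) • T (T x)‖ ^ 2 =
      ‖x‖ ^ 2 - 2 * (1 / L ^ 2) * ‖T x‖ ^ 2 + (1 / L ^ 2) ^ 2 * ‖T (T x)‖ ^ 2 := by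
    rw [norm_sub_sq_real, inner_smul_right, ← hsymm, real_inner_self_eq_norm_sq, norm_smul,
      mul_pow, Real.norm_eq_abs, sq_abs]
    ring
  have h2 : ‖T (T x)‖ ^ 2 ≤ L ^ 2 * ‖T x‖ ^ 2 := by
    rw [← mul_pow]; gcongr; exact hTL _
  have h3 : (1 / L ^ 2) ^ 2 * ‖T (T x)‖ ^ 2 ≤ 1 / L ^ 2 * ‖T x‖ ^ 2 := by
    calc _ ≤ (1 / L ^ 2) ^ 2 * (L ^ 2 * ‖T x‖ ^ 2) := by gcongr
      _ = _ := by field_simp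
  have h4 : ‖x‖ ^ 2 ≤ κ ^ 2 * ‖T x‖ ^ 2 := by
    rw [← mul_pow]; gcongr; exact hTκ _
  have h5 : 1 / (κ ^ 2 * L ^ 2) * ‖x‖ ^ 2 ≤ 1 / L ^ 2 * ‖T x‖ ^ 2 := by
    calc _ ≤ 1 / (κ ^ 2 * L ^ 2) * (κ ^ 2 * ‖T x‖ ^ 2) := by gcongr
      _ = _ := by field_simp
  have h6 : 1 - 1 / (κ ^ 2 * L ^ 2) ≤ Real.exp (-(1 / (2 * κ ^ 2 * L ^ 2))) ^ 2 := by
    rw [← Real.exp_nat_mul]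
    have := Real.add_one_le_exp (-(1 / (κ ^ 2 * L ^ 2)))
    refine (by linarith : _ ≤ _).trans (this.trans (le_of_eq ?_))
    congr 1
    push_cast
    field_simp
  rw [mul_pow, h1]
  have h7 : (1 - 1 / (κ ^ 2 * L ^ 2)) * ‖x‖ ^ 2 ≤
      Real.exp (-(1 / (2 * κ ^ 2 * L ^ 2))) ^ 2 * ‖x‖ ^ 2 := by gcongr
  linarith

end Contraction

/-! ### The operator of the optimality system -/

section KKT

open SeqSpace

variable {m n : Type*} [Fintype m] [Fintype n]

/-- Triples `(x, u, λ)` of square-summable sequences: the states `x₁, x₂, …`, the controls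
`u₀, u₁, …`, and the multipliers of the dynamics. -/
abbrev KKTSpace (n m : Type*) [Fintype n] [Fintype m] : Type _ :=
  WithLp 2 (SeqSpace n × WithLp 2 (SeqSpace m × SeqSpace n))

namespace KKTSpace

/-- The triple with the given components. -/
def mk (x : SeqSpace n) (u : SeqSpace m) (p : SeqSpace n) : KKTSpace n m :=
  WithLp.toLp 2 (x, WithLp.toLp 2 (u, p))

/-- The state component. -/
def st (z : KKTSpace n m) : SeqSpace n := z.fst

/-- The control component. -/
def ctl (z : KKTSpace n m) : SeqSpace m := z.snd.fst

/-- The multiplier component. -/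
def mult (z : KKTSpace n m) : SeqSpace n := z.snd.snd

@[simp] lemma st_mk (x : SeqSpace n) (u : SeqSpace m) (p : SeqSpace n) : st (mk x u p) = x := rfl
@[simp] lemma ctl_mk (x : SeqSpace n) (u : SeqSpace m) (p : SeqSpace n) : ctl (mk x u p) = u := rfl
@[simp] lemma mult_mk (x : SeqSpace n) (u : SeqSpace m) (p : SeqSpace n) :
    mult (mk x u p) = p := rfl

variable (z z' : KKTSpace n m) (c : ℝ)

@[simp] lemma st_add : st (z + z') = st z + st z' := rfl
@[simp] lemma ctl_add : ctl (z + z') = ctl z + ctl z' := rfl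
@[simp] lemma mult_add : mult (z + z') = mult z + mult z' := rfl
@[simp] lemma st_sub : st (z - z') = st z - st z' := rfl
@[simp] lemma ctl_sub : ctl (z - z') = ctl z - ctl z' := rfl
@[simp] lemma mult_sub : mult (z - z') = mult z - mult z' := rfl
@[simp] lemma st_smul : st (c • z) = c • st z := rfl
@[simp] lemma ctl_smul : ctl (c • z) = c • ctl z := rfl
@[simp] lemma mult_smul : mult (c • z) = c • mult z := rfl

variable {z z'} in
lemma ext_components (h1 : st z = st z') (h2 : ctl z = ctl z') (h3 : mult z = mult z') : z = z' :=
  WithLp.ofLp_injective 2 (Prod.ext h1 (WithLp.ofLp_injective 2 (Prod.ext h2 h3)))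

lemma inner_eq : ⟪z, z'⟫ = ⟪st z, st z'⟫ + (⟪ctl z, ctl z'⟫ + ⟪mult z, mult z'⟫) := rfl

lemma norm_sq_eq : ‖z‖ ^ 2 = ‖st z‖ ^ 2 + (‖ctl z‖ ^ 2 + ‖mult z‖ ^ 2) := by
  simp only [← real_inner_self_eq_norm_sq, inner_eq]

lemma norm_st_le : ‖st z‖ ≤ ‖z‖ :=
  le_of_sq_le_sq (by rw [norm_sq_eq z]; nlinarith [sq_nonneg ‖ctl z‖, sq_nonneg ‖mult z‖])
    (norm_nonneg _)

lemma norm_ctl_le : ‖ctl z‖ ≤ ‖z‖ :=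
  le_of_sq_le_sq (by rw [norm_sq_eq z]; nlinarith [sq_nonneg ‖st z‖, sq_nonneg ‖mult z‖])
    (norm_nonneg _)

lemma norm_mult_le : ‖mult z‖ ≤ ‖z‖ :=
  le_of_sq_le_sq (by rw [norm_sq_eq z]; nlinarith [sq_nonneg ‖st z‖, sq_nonneg ‖ctl z‖])
    (norm_nonneg _)

lemma norm_le_add : ‖z‖ ≤ ‖st z‖ + ‖ctl z‖ + ‖mult z‖ :=
  le_of_sq_le_sq (by
    rw [norm_sq_eq z]
    nlinarith [mul_nonneg (norm_nonneg (st z)) (norm_nonneg (ctl z)),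
      mul_nonneg (norm_nonneg (st z)) (norm_nonneg (mult z)),
      mul_nonneg (norm_nonneg (ctl z)) (norm_nonneg (mult z))]) (by positivity)

/-- `st` as a linear map. -/
noncomputable def stL : KKTSpace n m →ₗ[ℝ] SeqSpace n where
  toFun := st
  map_add' _ _ := rfl
  map_smul' _ _ := rfl

/-- `ctl` as a linear map. -/
noncomputable def ctlL : KKTSpace n m →ₗ[ℝ] SeqSpace m where
  toFun := ctl
  map_add' _ _ := rfl
  map_smul' _ _ := rfl

/-- `mult` as a linear map. -/
noncomputable def multL : KKTSpace n m →ₗ[ℝ] SeqSpace n where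
  toFun := mult
  map_add' _ _ := rfl
  map_smul' _ _ := rfl

/-- The linear map with given components. -/
noncomputable def combine {E : Type*} [AddCommGroup E] [Module ℝ E] (f : E →ₗ[ℝ] SeqSpace n)
    (g : E →ₗ[ℝ] SeqSpace m) (h : E →ₗ[ℝ] SeqSpace n) : E →ₗ[ℝ] KKTSpace n m where
  toFun z := KKTSpace.mk (f z) (g z) (h z)
  map_add' z z' := by rw [map_add, map_add, map_add]; rfl
  map_smul' c z := by rw [map_smul, map_smul, map_smul]; rfl

end KKTSpace

open KKTSpace

variable [DecidableEq m] [DecidableEq n]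

/-- The operator of the optimality (Karush–Kuhn–Tucker) system of the infinite-horizon LQR problem
with initial state `0`; every equation couples adjacent times only. -/
noncomputable def kkt (A : Matrix n n ℝ) (B : Matrix n m ℝ) (Q : Matrix n n ℝ) (R : Matrix m m ℝ)
    (S : Matrix m n ℝ) : KKTSpace n m →ₗ[ℝ] KKTSpace n m :=
  combine
    (mulSeq Q ∘ₗ stL + mulSeq Sᵀ ∘ₗ shiftL ∘ₗ ctlL + mulSeq Aᵀ ∘ₗ shiftL ∘ₗ multL - multL)
    (mulSeq R ∘ₗ ctlL + mulSeq S ∘ₗ shiftR ∘ₗ stL + mulSeq Bᵀ ∘ₗ multL)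
    (mulSeq B ∘ₗ ctlL + mulSeq A ∘ₗ shiftR ∘ₗ stL - stL)

lemma st_kkt (A : Matrix n n ℝ) (B : Matrix n m ℝ) (Q : Matrix n n ℝ) (R : Matrix m m ℝ)
    (S : Matrix m n ℝ) (z : KKTSpace n m) : st (kkt A B Q R S z) =
      mulSeq Q (st z) + mulSeq Sᵀ (shiftL (ctl z)) + mulSeq Aᵀ (shiftL (mult z)) - mult z := rfl

lemma ctl_kkt (A : Matrix n n ℝ) (B : Matrix n m ℝ) (Q : Matrix n n ℝ) (R : Matrix m m ℝ)
    (S : Matrix m n ℝ) (z : KKTSpace n m) : ctl (kkt A B Q R S z) =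
      mulSeq R (ctl z) + mulSeq S (shiftR (st z)) + mulSeq Bᵀ (mult z) := rfl

lemma mult_kkt (A : Matrix n n ℝ) (B : Matrix n m ℝ) (Q : Matrix n n ℝ) (R : Matrix m m ℝ)
    (S : Matrix m n ℝ) (z : KKTSpace n m) : mult (kkt A B Q R S z) =
      mulSeq B (ctl z) + mulSeq A (shiftR (st z)) - st z := rfl

variable (A : Matrix n n ℝ) (B : Matrix n m ℝ) {Q : Matrix n n ℝ} {R : Matrix m m ℝ}
  (S : Matrix m n ℝ)

lemma kkt_symm (hQ : Qᵀ = Q) (hR : Rᵀ = R) (z z' : KKTSpace n m) :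
    ⟪kkt A B Q R S z, z'⟫ = ⟪z, kkt A B Q R S z'⟫ := by
  have e1 : ∀ (X : Matrix n n ℝ) (y y' : SeqSpace n),
      ⟪mulSeq Xᵀ (shiftL y), y'⟫ = ⟪y, mulSeq X (shiftR y')⟫ := fun X y y' => by
    rw [inner_mulSeq, Matrix.transpose_transpose, inner_shiftL, shiftR_mulSeq]
  have e2 : ∀ (y : SeqSpace m) (y' : SeqSpace n),
      ⟪mulSeq Sᵀ (shiftL y), y'⟫ = ⟪y, mulSeq S (shiftR y')⟫ := fun y y' => by
    rw [inner_mulSeq, Matrix.transpose_transpose, inner_shiftL, shiftR_mulSeq]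
  have e3 : ∀ (y : SeqSpace n) (y' : SeqSpace n),
      ⟪mulSeq A (shiftR y), y'⟫ = ⟪y, mulSeq Aᵀ (shiftL y')⟫ := fun y y' => by
    rw [real_inner_comm, ← e1, real_inner_comm]
  have e4 : ∀ (y : SeqSpace n) (y' : SeqSpace m),
      ⟪mulSeq S (shiftR y), y'⟫ = ⟪y, mulSeq Sᵀ (shiftL y')⟫ := fun y y' => by
    rw [real_inner_comm, ← e2, real_inner_comm]
  rw [inner_eq, inner_eq]
  simp only [st_kkt, ctl_kkt, mult_kkt, inner_add_left, inner_add_right, inner_sub_left,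
    inner_sub_right, e1, e2, e3, e4]
  rw [inner_mulSeq _ Q, inner_mulSeq _ R, inner_mulSeq _ Bᵀ, inner_mulSeq _ B, hQ, hR,
    Matrix.transpose_transpose]
  ring

/-- A bound for the norm of the KKT operator; `k`, `τ` enter through
`‖A‖ ≤ ‖A - B K₀‖ + ‖B‖ ‖K₀‖`. -/
def kktNorm {α : Type*} [CommSemiring α] (τ k nB nQ nR nS : α) : α :=
  3 * (1 + nQ + nR + nS + nB + τ + nB * k)

lemma norm_kkt_le {τ k : ℝ} (hA : ‖A‖ ≤ τ + ‖B‖ * k) (z : KKTSpace n m) :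
    ‖kkt A B Q R S z‖ ≤ kktNorm τ k ‖B‖ ‖Q‖ ‖R‖ ‖S‖ * ‖z‖ := by
  have hx := norm_st_le z
  have hu := norm_ctl_le z
  have hp := norm_mult_le z
  have z0 := norm_nonneg z
  have hQx := (norm_mulSeq_le Q (st z)).trans (mul_le_mul_of_nonneg_left hx (norm_nonneg Q))
  have hRu := (norm_mulSeq_le R (ctl z)).trans (mul_le_mul_of_nonneg_left hu (norm_nonneg R))
  have hBu := (norm_mulSeq_le B (ctl z)).trans (mul_le_mul_of_nonneg_left hu (norm_nonneg B))
  have hBp := (norm_mulSeq_le Bᵀ (mult z)).trans (mul_le_mul_of_nonneg_left hp (norm_nonneg Bᵀ))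
  have hSu := (norm_mulSeq_le Sᵀ (shiftL (ctl z))).trans
    (mul_le_mul_of_nonneg_left ((norm_shiftL_le _).trans hu) (norm_nonneg Sᵀ))
  have hSx := (norm_mulSeq_le S (shiftR (st z))).trans
    (mul_le_mul_of_nonneg_left ((norm_shiftR _).trans_le hx) (norm_nonneg S))
  have hAp := (norm_mulSeq_le Aᵀ (shiftL (mult z))).trans
    (mul_le_mul_of_nonneg_left ((norm_shiftL_le _).trans hp) (norm_nonneg Aᵀ))
  have hAx := (norm_mulSeq_le A (shiftR (st z))).trans
    (mul_le_mul_of_nonneg_left ((norm_shiftR _).trans_le hx) (norm_nonneg A))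
  rw [norm_transpose_eq] at hBp hSu hAp
  have h1 := norm_sub_le_of_le (norm_add_le_of_le (norm_add_le_of_le hQx hSu) hAp) hp
  have h2 := norm_add_le_of_le (norm_add_le_of_le hRu hSx) hBp
  have h3 := norm_sub_le_of_le (norm_add_le_of_le hBu hAx) hx
  rw [← st_kkt A B Q R S] at h1
  rw [← ctl_kkt A B Q R S] at h2
  rw [← mult_kkt A B Q R S] at h3
  have h4 := norm_le_add (kkt A B Q R S z)
  have hA' := mul_le_mul_of_nonneg_right hA z0
  have := mul_nonneg (norm_nonneg Q) z0
  have := mul_nonneg (norm_nonneg R) z0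
  have := mul_nonneg (norm_nonneg B) z0
  have := mul_nonneg (norm_nonneg S) z0
  have := mul_nonneg (norm_nonneg A) z0
  rw [kktNorm]
  linarith

/-- The inverse of the KKT operator has norm at most this. Here `w` is the coercivity constant of
the stage cost and `Θ` the constant of the closed loop `A - B K₀`. -/
def kktInv {α : Type*} [CommSemiring α] (w Θ k nQ nR nS : α) : α :=
  (2 + Θ * (1 + k) * (1 + nQ + nR + nS)) *
    (w * (2 + Θ * (1 + k) * (1 + nQ + nR + nS)) + 2)

/-- The multipliers are controlled by the residual and by the primal variables. -/
lemma norm_mult_le_of_stable {K₀ : Matrix m n ℝ} {τ ρ Θ k e Z : ℝ} (hρ : 0 < ρ)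
    (hstab : IsExpStable τ ρ (A - B * K₀)) (hΘ : τ / (1 - Real.exp (-ρ)) ≤ Θ) (hΘ0 : 0 ≤ Θ)
    (hk : ‖K₀‖ ≤ k) (z : KKTSpace n m) (he : ‖kkt A B Q R S z‖ ≤ e) (hxZ : ‖st z‖ ≤ Z)
    (huZ : ‖ctl z‖ ≤ Z) :
    ‖mult z‖ ≤ Θ * (1 + k) * (1 + ‖Q‖ + ‖R‖ + ‖S‖) * (e + Z) := by
  have hfe := (norm_st_le (kkt A B Q R S z)).trans he
  have hge := (norm_ctl_le (kkt A B Q R S z)).trans he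
  have hf := st_kkt A B Q R S z
  have hg := ctl_kkt A B Q R S z
  generalize st (kkt A B Q R S z) = f at *
  generalize ctl (kkt A B Q R S z) = g at *
  have e0 : 0 ≤ e := (norm_nonneg _).trans he
  clear he
  generalize st z = x at *
  generalize ctl z = u at *
  generalize mult z = p at *
  have hk0 : 0 ≤ k := (norm_nonneg _).trans hk
  have Z0 : 0 ≤ Z := (norm_nonneg _).trans hxZ
  obtain ⟨r, hr⟩ : ∃ r, r = f - mulSeq Q x - mulSeq Sᵀ (shiftL u) := ⟨_, rfl⟩
  obtain ⟨s, hs⟩ : ∃ s, s = g - mulSeq R u - mulSeq S (shiftR x) := ⟨_, rfl⟩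
  have hr' : r = mulSeq Aᵀ (shiftL p) - p := by rw [hr, hf]; abel
  have hs' : s = mulSeq Bᵀ p := by rw [hs, hg]; abel
  have hres : mulSeq (A - B * K₀)ᵀ (shiftL p) - p = r - mulSeq K₀ᵀ (shiftL s) := by
    rw [hr', hs', shiftL_mulSeq, mulSeq_mulSeq, Matrix.transpose_sub, Matrix.transpose_mul,
      mulSeq_sub]
    abel
  have hmain := norm_le_of_mulSeq_shiftL_sub _ hρ hstab hΘ hres
  have hrn : ‖r‖ ≤ e + ‖Q‖ * Z + ‖S‖ * Z := by
    rw [hr]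
    refine norm_sub_le_of_le (norm_sub_le_of_le hfe ?_) ?_
    · exact (norm_mulSeq_le _ _).trans (by gcongr)
    · rw [← norm_transpose_eq S]
      exact (norm_mulSeq_le _ _).trans (by gcongr; exact (norm_shiftL_le _).trans huZ)
  have hsn : ‖s‖ ≤ e + ‖R‖ * Z + ‖S‖ * Z := by
    rw [hs]
    refine norm_sub_le_of_le (norm_sub_le_of_le hge ?_) ?_
    · exact (norm_mulSeq_le _ _).trans (by gcongr)
    · exact (norm_mulSeq_le _ _).trans (by gcongr; exact (norm_shiftR _).trans_le hxZ)
  have hKs : ‖mulSeq K₀ᵀ (shiftL s)‖ ≤ k * (e + ‖R‖ * Z + ‖S‖ * Z) := by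
    refine (norm_mulSeq_le _ _).trans ?_
    rw [norm_transpose_eq]
    gcongr
    exact (norm_shiftL_le _).trans hsn
  refine hmain.trans ?_
  rw [mul_assoc, mul_assoc]
  gcongr
  refine (norm_sub_le_of_le hrn hKs).trans ?_
  have h1 : e + ‖Q‖ * Z + ‖S‖ * Z ≤ (1 + ‖Q‖ + ‖R‖ + ‖S‖) * (e + Z) := by
    have : 0 ≤ (‖Q‖ + ‖R‖ + ‖S‖) * e + Z + ‖R‖ * Z := by positivity
    linarith
  have h2 : e + ‖R‖ * Z + ‖S‖ * Z ≤ (1 + ‖Q‖ + ‖R‖ + ‖S‖) * (e + Z) := by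
    have : 0 ≤ (‖Q‖ + ‖R‖ + ‖S‖) * e + Z + ‖Q‖ * Z := by positivity
    linarith
  have h3 := mul_le_mul_of_nonneg_left h2 hk0
  linarith

/-- Pairing the equations of the optimality system with `(x, u, -λ)` leaves the quadratic cost: the
contributions of the dynamics cancel. -/
lemma hasSum_stageCost (z : KKTSpace n m) :
    HasSum (fun t => stageCost Q R S (coord (shiftR (st z)) t) (coord (ctl z) t))
      (⟪st z, st (kkt A B Q R S z)⟫ + ⟪ctl z, ctl (kkt A B Q R S z)⟫ -
        ⟪mult z, mult (kkt A B Q R S z)⟫) := by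
  rw [st_kkt, ctl_kkt, mult_kkt]
  generalize st z = x
  generalize ctl z = u
  generalize mult z = p
  have h1 := hasSum_inner_coord (shiftR x) (mulSeq Q (shiftR x))
  have h2 := hasSum_inner_coord u (mulSeq R u)
  have h3 := (hasSum_inner_coord u (mulSeq S (shiftR x))).mul_left 2
  have h4 := (h1.add h2).add h3
  have a1 : ⟪shiftR x, mulSeq Q (shiftR x)⟫ = ⟪x, mulSeq Q x⟫ := by
    rw [← shiftR_mulSeq, ← inner_shiftL, shiftL_shiftR]
  have a2 : ⟪x, mulSeq Sᵀ (shiftL u)⟫ = ⟪u, mulSeq S (shiftR x)⟫ := by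
    rw [real_inner_comm, inner_mulSeq, Matrix.transpose_transpose, inner_shiftL, shiftR_mulSeq]
  have a3 : ⟪x, mulSeq Aᵀ (shiftL p)⟫ = ⟪p, mulSeq A (shiftR x)⟫ := by
    rw [real_inner_comm, inner_mulSeq, Matrix.transpose_transpose, inner_shiftL, shiftR_mulSeq]
  have a4 : ⟪u, mulSeq Bᵀ p⟫ = ⟪p, mulSeq B u⟫ := by
    rw [real_inner_comm, inner_mulSeq, Matrix.transpose_transpose]
  have a5 : ⟪x, p⟫ = ⟪p, x⟫ := real_inner_comm _ _
  have hval : ⟪shiftR x, mulSeq Q (shiftR x)⟫ + ⟪u, mulSeq R u⟫ + 2 * ⟪u, mulSeq S (shiftR x)⟫ =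
      ⟪x, mulSeq Q x + mulSeq Sᵀ (shiftL u) + mulSeq Aᵀ (shiftL p) - p⟫ +
        ⟪u, mulSeq R u + mulSeq S (shiftR x) + mulSeq Bᵀ p⟫ -
        ⟪p, mulSeq B u + mulSeq A (shiftR x) - x⟫ := by
    simp only [inner_add_right, inner_sub_right, a1, a2, a3, a4, a5]
    ring
  rw [← hval]
  exact h4

/-- The KKT operator is bounded below: coercivity of the cost controls the primal variables, and
stability of `A - B K₀` the multipliers. -/
lemma norm_le_kktInv_mul {K₀ : Matrix m n ℝ} {τ ρ Θ k w : ℝ} (hρ : 0 < ρ)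
    (hstab : IsExpStable τ ρ (A - B * K₀)) (hΘ : τ / (1 - Real.exp (-ρ)) ≤ Θ) (hΘ0 : 0 ≤ Θ)
    (hk : ‖K₀‖ ≤ k) (hw : 0 ≤ w)
    (hcoer : ∀ x u, x ⬝ᵥ x + u ⬝ᵥ u ≤ w * stageCost Q R S x u) (z : KKTSpace n m) :
    ‖z‖ ≤ kktInv w Θ k ‖Q‖ ‖R‖ ‖S‖ * ‖kkt A B Q R S z‖ := by
  have hz := norm_le_add z
  have hfe := norm_st_le (kkt A B Q R S z)
  have hge := norm_ctl_le (kkt A B Q R S z)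
  have hhe := norm_mult_le (kkt A B Q R S z)
  have hk0 : 0 ≤ k := (norm_nonneg _).trans hk
  obtain ⟨Z, hZ⟩ : ∃ Z, Z = Real.sqrt (‖st z‖ ^ 2 + ‖ctl z‖ ^ 2) := ⟨_, rfl⟩
  have Z0 : 0 ≤ Z := hZ ▸ Real.sqrt_nonneg _
  have hZ2 : Z ^ 2 = ‖st z‖ ^ 2 + ‖ctl z‖ ^ 2 := by rw [hZ, Real.sq_sqrt (by positivity)]
  have hxZ : ‖st z‖ ≤ Z := le_of_sq_le_sq (by rw [hZ2]; linarith [sq_nonneg ‖ctl z‖]) Z0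
  have huZ : ‖ctl z‖ ≤ Z := le_of_sq_le_sq (by rw [hZ2]; linarith [sq_nonneg ‖st z‖]) Z0
  have hp := norm_mult_le_of_stable A B S hρ hstab hΘ hΘ0 hk z (le_refl ‖kkt A B Q R S z‖) hxZ huZ
  have hZw : Z ^ 2 ≤ w * (⟪st z, st (kkt A B Q R S z)⟫ + ⟪ctl z, ctl (kkt A B Q R S z)⟫ -
        ⟪mult z, mult (kkt A B Q R S z)⟫) := by
    rw [hZ2, ← norm_shiftR (st z)]
    exact hasSum_le (fun t => hcoer _ _) ((shiftR (st z)).hasSum_norm_sq.add (ctl z).hasSum_norm_sq)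
      ((hasSum_stageCost A B S z).mul_left w)
  have h1 := (real_inner_le_norm (st z) (st (kkt A B Q R S z))).trans
    (mul_le_mul hxZ hfe (norm_nonneg _) Z0)
  have h2 := (real_inner_le_norm (ctl z) (ctl (kkt A B Q R S z))).trans
    (mul_le_mul huZ hge (norm_nonneg _) Z0)
  have h3 := (neg_le_abs _).trans ((abs_real_inner_le_norm (mult z) (mult (kkt A B Q R S z))).trans
      (mul_le_mul hp hhe (norm_nonneg _) ((norm_nonneg _).trans hp)))
  have e0 := norm_nonneg (kkt A B Q R S z)
  have c0 : 0 ≤ Θ * (1 + k) * (1 + ‖Q‖ + ‖R‖ + ‖S‖) := by positivity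
  rw [kktInv]
  generalize Θ * (1 + k) * (1 + ‖Q‖ + ‖R‖ + ‖S‖) = c at *
  generalize ‖kkt A B Q R S z‖ = e at *
  have hpair := mul_le_mul_of_nonneg_left (add_le_add (add_le_add h1 h2) h3) hw
  obtain ⟨b, hb⟩ : ∃ b, b = w * (2 + c) := ⟨_, rfl⟩
  have b0 : 0 ≤ b := by rw [hb]; positivity
  have hquad : Z ^ 2 ≤ b * e * Z + b * e ^ 2 := by
    have h2 : 0 ≤ 2 * w * e ^ 2 := by positivity
    rw [hb]
    linarith
  have hZe : Z ≤ (b + 1) * e := by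
    by_contra hcon
    push Not at hcon
    have h1 : b * e + e < Z := by linarith
    nlinarith [mul_nonneg b0 e0]
  have hp' : ‖mult z‖ ≤ c * (e + (b + 1) * e) := hp.trans (by gcongr)
  rw [← hb]
  have : 0 ≤ b * e := by positivity
  linarith

end KKT

/-! ### Gradient descent towards the optimal trajectory -/

section Iteration

open SeqSpace KKTSpace

variable {m n : Type*} [Fintype m] [Fintype n]

/-- Triples of matrix sequences, the matrix version of `KKTSpace`: applied to an initial state, such
a triple gives sequences of states, controls and multipliers. -/
structure MatSeq (n m : Type*) where
  /-- The state component. -/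
  st : ℕ → Matrix n n ℝ
  /-- The control component. -/
  ctl : ℕ → Matrix m n ℝ
  /-- The multiplier component. -/
  mult : ℕ → Matrix n n ℝ

/-- `kkt` on matrix sequences. -/
def MatSeq.kkt (A : Matrix n n ℝ) (B : Matrix n m ℝ) (Q : Matrix n n ℝ) (R : Matrix m m ℝ)
    (S : Matrix m n ℝ) (V : MatSeq n m) : MatSeq n m where
  st t := Q * V.st t + Sᵀ * V.ctl (t + 1) + Aᵀ * V.mult (t + 1) - V.mult t
  ctl t := R * V.ctl t + S * rightShift V.st t + Bᵀ * V.mult t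
  mult t := B * V.ctl t + A * rightShift V.st t - V.st t

/-- The residual of the optimality system: the initial state enters the equations at time `0`,
through `S` and `A`. -/
def MatSeq.residual (A : Matrix n n ℝ) (B : Matrix n m ℝ) (Q : Matrix n n ℝ) (R : Matrix m m ℝ)
    (S : Matrix m n ℝ) (V : MatSeq n m) : MatSeq n m where
  st t := (V.kkt A B Q R S).st t
  ctl t := (V.kkt A B Q R S).ctl t + if t = 0 then S else 0
  mult t := (V.kkt A B Q R S).mult t + if t = 0 then A else 0

/-- One step of gradient descent, with step size `η`, on the squared residual. -/
def MatSeq.step (A : Matrix n n ℝ) (B : Matrix n m ℝ) (Q : Matrix n n ℝ) (R : Matrix m m ℝ)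
    (S : Matrix m n ℝ) (η : ℝ) (V : MatSeq n m) : MatSeq n m where
  st t := V.st t - η • ((V.residual A B Q R S).kkt A B Q R S).st t
  ctl t := V.ctl t - η • ((V.residual A B Q R S).kkt A B Q R S).ctl t
  mult t := V.mult t - η • ((V.residual A B Q R S).kkt A B Q R S).mult t

/-- The iterates of gradient descent on the squared residual, started at `0`. -/
def MatSeq.iter (A : Matrix n n ℝ) (B : Matrix n m ℝ) (Q : Matrix n n ℝ) (R : Matrix m m ℝ)
    (S : Matrix m n ℝ) (η : ℝ) : ℕ → MatSeq n m
  | 0 => ⟨fun _ => 0, fun _ => 0, fun _ => 0⟩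
  | k + 1 => (MatSeq.iter A B Q R S η k).step A B Q R S η

/-- `z` is the triple of sequences that `V` produces from the initial state `x₀`. -/
structure Represents (V : MatSeq n m) (x₀ : n → ℝ) (z : KKTSpace n m) : Prop where
  st : ∀ t, coord (st z) t = V.st t *ᵥ x₀
  ctl : ∀ t, coord (ctl z) t = V.ctl t *ᵥ x₀
  mult : ∀ t, coord (mult z) t = V.mult t *ᵥ x₀

lemma Represents.coord_shiftR {V : MatSeq n m} {x₀ : n → ℝ} {z : KKTSpace n m}
    (h : Represents V x₀ z) (t : ℕ) :
    coord (shiftR (KKTSpace.st z)) t = rightShift V.st t *ᵥ x₀ := by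
  cases t with
  | zero => simp [rightShift]
  | succ t => simp [rightShift, h.st]

variable [DecidableEq m] [DecidableEq n] {A : Matrix n n ℝ} {B : Matrix n m ℝ} {Q : Matrix n n ℝ}
  {R : Matrix m m ℝ} {S : Matrix m n ℝ}

lemma Represents.kkt {V : MatSeq n m} {x₀ : n → ℝ} {z : KKTSpace n m} (h : Represents V x₀ z) :
    Represents (V.kkt A B Q R S) x₀ (kkt A B Q R S z) where
  st t := by
    rw [st_kkt]
    simp only [coord_sub, coord_add, coord_mulSeq, coord_shiftL, h.st, h.ctl, h.mult,
      MatSeq.kkt, Matrix.sub_mulVec, Matrix.add_mulVec, Matrix.mulVec_mulVec]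
  ctl t := by
    rw [ctl_kkt]
    simp only [coord_add, coord_mulSeq, h.coord_shiftR, h.ctl, h.mult,
      MatSeq.kkt, Matrix.add_mulVec, Matrix.mulVec_mulVec]
  mult t := by
    rw [mult_kkt]
    simp only [coord_sub, coord_add, coord_mulSeq, h.coord_shiftR, h.ctl, h.st,
      MatSeq.kkt, Matrix.sub_mulVec, Matrix.add_mulVec, Matrix.mulVec_mulVec]

/-- The sequence with value `v` at time `0` and zero afterwards. -/
noncomputable def impulse (v : n → ℝ) : SeqSpace n :=
  SeqSpace.mk (fun t => if t = 0 then v else 0)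
    (summable_of_ne_finset_zero (s := {0}) fun t ht => by simp [Finset.mem_singleton.not.mp ht])

variable (A S) in
/-- The inhomogeneity of the optimality system with initial state `x₀`. -/
noncomputable def kktRhs (x₀ : n → ℝ) : KKTSpace n m :=
  KKTSpace.mk 0 (impulse (S *ᵥ x₀)) (impulse (A *ᵥ x₀))

lemma Represents.residual {V : MatSeq n m} {x₀ : n → ℝ} {z : KKTSpace n m}
    (h : Represents V x₀ z) :
    Represents (V.residual A B Q R S) x₀ (NetworkLQR.kkt A B Q R S z + kktRhs A S x₀) where
  st t := by
    rw [st_add, coord_add, h.kkt.st]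
    simp [MatSeq.residual, kktRhs]
  ctl t := by
    rw [ctl_add, coord_add, h.kkt.ctl]
    simp only [MatSeq.residual, kktRhs, Matrix.add_mulVec, ctl_mk, impulse, coord_mk]
    split_ifs <;> simp
  mult t := by
    rw [mult_add, coord_add, h.kkt.mult]
    simp only [MatSeq.residual, kktRhs, Matrix.add_mulVec, mult_mk, impulse, coord_mk]
    split_ifs <;> simp

lemma Represents.step {V : MatSeq n m} {x₀ : n → ℝ} {z : KKTSpace n m} (h : Represents V x₀ z)
    (η : ℝ) :
    Represents (V.step A B Q R S η) x₀
      (z - η • NetworkLQR.kkt A B Q R S (NetworkLQR.kkt A B Q R S z + kktRhs A S x₀)) where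
  st t := by
    rw [st_sub, st_smul, coord_sub, coord_smul, h.residual.kkt.st, h.st]
    simp [MatSeq.step, Matrix.sub_mulVec, Matrix.smul_mulVec]
  ctl t := by
    rw [ctl_sub, ctl_smul, coord_sub, coord_smul, h.residual.kkt.ctl, h.ctl]
    simp [MatSeq.step, Matrix.sub_mulVec, Matrix.smul_mulVec]
  mult t := by
    rw [mult_sub, mult_smul, coord_sub, coord_smul, h.residual.kkt.mult, h.mult]
    simp [MatSeq.step, Matrix.sub_mulVec, Matrix.smul_mulVec]

/-- Gradient descent started at `0` converges geometrically to a solution of the optimality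
system. -/
lemma exists_represents_iter {L κ : ℝ} (hQ : Qᵀ = Q) (hR : Rᵀ = R) (hL : 0 < L) (hκ : 0 < κ)
    (hTL : ∀ z, ‖NetworkLQR.kkt A B Q R S z‖ ≤ L * ‖z‖)
    (hTκ : ∀ z, ‖z‖ ≤ κ * ‖NetworkLQR.kkt A B Q R S z‖) {x₀ : n → ℝ} {z' : KKTSpace n m}
    (hz' : NetworkLQR.kkt A B Q R S z' + kktRhs A S x₀ = 0) (k : ℕ) :
    ∃ z, Represents (MatSeq.iter A B Q R S (1 / L ^ 2) k) x₀ z ∧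
      ‖z - z'‖ ≤ Real.exp (-(1 / (2 * κ ^ 2 * L ^ 2)) * k) * ‖z'‖ := by
  induction k with
  | zero =>
    refine ⟨0, ⟨fun t => ?_, fun t => ?_, fun t => ?_⟩, by simp⟩ <;> simp only [MatSeq.iter,
      Matrix.zero_mulVec] <;> rfl
  | succ k ih =>
    obtain ⟨z, hz, hzn⟩ := ih
    refine ⟨_, hz.step (1 / L ^ 2), ?_⟩
    have e : NetworkLQR.kkt A B Q R S z + kktRhs A S x₀ = NetworkLQR.kkt A B Q R S (z - z') := by
      rw [map_sub, eq_neg_of_add_eq_zero_left hz', sub_neg_eq_add]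
    rw [e, sub_right_comm]
    refine (norm_gradient_step_le _ (kkt_symm A B S hQ hR) hL hTL hκ hTκ (z - z')).trans ?_
    calc _ ≤ Real.exp (-(1 / (2 * κ ^ 2 * L ^ 2))) *
          (Real.exp (-(1 / (2 * κ ^ 2 * L ^ 2)) * k) * ‖z'‖) := by gcongr
      _ = _ := by
        rw [← mul_assoc, ← Real.exp_add]
        congr 2
        push_cast
        ring

/-- A stable closed loop produces square-summable sequences. The factor `1 / (1 - e^{-2ρ})` is at
least `1`, and replaces its square root. -/
lemma exists_seq_stable {l : Type*} [Fintype l] {F : Matrix n n ℝ} {τ ρ : ℝ} (hρ : 0 < ρ)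
    (hτ : 0 ≤ τ) (hF : IsExpStable τ ρ F) (G : Matrix l n ℝ) (x₀ : n → ℝ) :
    ∃ y : SeqSpace l, (∀ t, coord y t = (G * F ^ t) *ᵥ x₀) ∧
      ‖y‖ ≤ ‖G‖ * (τ * (1 / (1 - Real.exp (-2 * ρ)))) * ‖WithLp.toLp 2 x₀‖ := by
  have hle : ∀ t : ℕ, ((G * F ^ t) *ᵥ x₀) ⬝ᵥ ((G * F ^ t) *ᵥ x₀) ≤
      (τ * Real.exp (-ρ * t)) ^ 2 * (‖G‖ ^ 2 * ‖WithLp.toLp 2 x₀‖ ^ 2) := by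
    intro t
    refine (mulVec_dotProduct_self_le _ _).trans ?_
    rw [dotProduct_self_eq_norm_sq]
    have h1 : ‖G * F ^ t‖ ≤ ‖G‖ * (τ * Real.exp (-ρ * t)) :=
      (Matrix.l2_opNorm_mul _ _).trans (by gcongr; exact hF t)
    calc _ ≤ (‖G‖ * (τ * Real.exp (-ρ * t))) ^ 2 * ‖WithLp.toLp 2 x₀‖ ^ 2 := by gcongr
      _ = _ := by ring
  have hs := (hasSum_exp_sq τ hρ).mul_right (‖G‖ ^ 2 * ‖WithLp.toLp 2 x₀‖ ^ 2)
  obtain ⟨y, hy⟩ : ∃ y : SeqSpace l, ∀ t, coord y t = (G * F ^ t) *ᵥ x₀ :=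
    ⟨SeqSpace.mk (fun t => (G * F ^ t) *ᵥ x₀)
      (Summable.of_nonneg_of_le (fun _ => zero_le_dotProduct_self _) hle hs.summable), fun _ => rfl⟩
  refine ⟨y, hy, ?_⟩
  have hg : 1 ≤ 1 / (1 - Real.exp (-2 * ρ)) := by
    have h1 := exp_neg_two_mul_lt_one hρ
    have h2 := Real.exp_pos (-2 * ρ)
    rw [le_div_iff₀ (by linarith)]
    linarith
  have hy2 := hasSum_le (fun t => by rw [hy]; exact hle t) y.hasSum_norm_sq hs
  generalize 1 / (1 - Real.exp (-2 * ρ)) = g at hg hy2 ⊢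
  refine le_of_sq_le_sq (hy2.trans ?_) (by positivity)
  have h3 : g ≤ g ^ 2 := by nlinarith
  calc _ ≤ τ ^ 2 * g ^ 2 * (‖G‖ ^ 2 * ‖WithLp.toLp 2 x₀‖ ^ 2) := by gcongr
    _ = _ := by ring

/-- A bound for the norm of the optimal trajectory from a unit initial state; `g` stands for
`1 / (1 - e^{-2ρ})`. -/
def trajConst {α : Type*} [CommSemiring α] (τ g nQ nR nS nK : α) : α :=
  τ * g * (τ + nK + τ ^ 3 * g * (nQ + 2 * nS * nK + nR * nK ^ 2))

/-- The closed-loop trajectory of the optimal gain, with multipliers `P x_{t+1}`, solves the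
optimality system. -/
lemma exists_optimal_trajectory {K : Matrix m n ℝ} {τ ρ : ℝ} (hρ : 0 < ρ) (hτ : 1 ≤ τ)
    (hstab : IsExpStable τ ρ (A - B * K))
    (hric : (R + Bᵀ * lyap (A - B * K) (gainCost Q R S K) * B) * K =
      Bᵀ * lyap (A - B * K) (gainCost Q R S K) * A + S) (x₀ : n → ℝ) :
    ∃ z : KKTSpace n m, NetworkLQR.kkt A B Q R S z + kktRhs A S x₀ = 0 ∧
      coord (ctl z) 0 = -(K *ᵥ x₀) ∧
      ‖z‖ ≤ trajConst τ (1 / (1 - Real.exp (-2 * ρ))) ‖Q‖ ‖R‖ ‖S‖ ‖K‖ * ‖WithLp.toLp 2 x₀‖ := by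
  set P := lyap (A - B * K) (gainCost Q R S K) with hP
  set F := A - B * K with hF
  have hlyap : P = gainCost Q R S K + Fᵀ * P * F := lyap_eq hρ hstab _
  have hτ0 : 0 ≤ τ := by linarith
  obtain ⟨x, hx, hxn⟩ := exists_seq_stable hρ hτ0 hstab F x₀
  obtain ⟨u, hu, hun⟩ := exists_seq_stable hρ hτ0 hstab (-K) x₀
  obtain ⟨p, hp, hpn⟩ := exists_seq_stable hρ hτ0 hstab (P * F) x₀
  have hctl : R * K = S + Bᵀ * P * F := by
    have : R * K + Bᵀ * P * B * K = Bᵀ * P * A + S := by rw [← hric, Matrix.add_mul]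
    rw [hF, Matrix.mul_sub, ← Matrix.mul_assoc (Bᵀ * P) B K, eq_sub_of_add_eq this]
    abel
  have hst : P = Q - Sᵀ * K + Aᵀ * P * F := by
    have h1 : gainCost Q R S K + Fᵀ * P * F = Q - Sᵀ * K + Aᵀ * P * F +
        Kᵀ * (R * K - (S + Bᵀ * P * F)) := by
      rw [gainCost, show Fᵀ = Aᵀ - Kᵀ * Bᵀ by rw [hF, Matrix.transpose_sub, Matrix.transpose_mul]]
      simp only [Matrix.sub_mul, Matrix.mul_sub, Matrix.mul_add, Matrix.mul_assoc]
      abel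
    rw [hctl, sub_self, Matrix.mul_zero, add_zero] at h1
    rw [← h1]
    exact hlyap
  refine ⟨KKTSpace.mk x u p, ?_, by simp [hu, Matrix.neg_mulVec], ?_⟩
  · have hrep : Represents (m := m) ⟨fun t => F * F ^ t, fun t => -K * F ^ t,
        fun t => P * F * F ^ t⟩ x₀ (KKTSpace.mk x u p) := ⟨hx, hu, hp⟩
    have hres := hrep.residual (A := A) (B := B) (Q := Q) (R := R) (S := S)
    have hsh : ∀ t : ℕ, rightShift (fun t => F * F ^ t) t = if t = 0 then 0 else F ^ t := by
      intro t
      cases t with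
      | zero => rfl
      | succ t => simp [rightShift, pow_succ']
    refine ext_components (ext_coord fun t => ?_) (ext_coord fun t => ?_) (ext_coord fun t => ?_)
    · rw [hres.st]
      have : Q * (F * F ^ t) + Sᵀ * (-K * F ^ (t + 1)) + Aᵀ * (P * F * F ^ (t + 1)) -
          P * F * F ^ t = 0 := by
        have h2 : P * F * F ^ t = (Q - Sᵀ * K + Aᵀ * P * F) * (F * F ^ t) := by
          rw [← hst, Matrix.mul_assoc]
        rw [h2, pow_succ']
        simp only [Matrix.add_mul, Matrix.sub_mul, Matrix.mul_assoc, Matrix.neg_mul,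
          Matrix.mul_neg]
        abel
      simp only [MatSeq.residual, MatSeq.kkt, this, Matrix.zero_mulVec]
      rfl
    · rw [hres.ctl]
      have : R * (-K * F ^ t) + S * (if t = 0 then 0 else F ^ t) + Bᵀ * (P * F * F ^ t) +
          (if t = 0 then S else 0) = 0 := by
        have h2 : R * (-K * F ^ t) = -(S * F ^ t + Bᵀ * (P * F * F ^ t)) := by
          rw [Matrix.neg_mul, Matrix.mul_neg, ← Matrix.mul_assoc, hctl]
          simp only [Matrix.add_mul, Matrix.mul_assoc]
        rw [h2]
        split_ifs with ht
        · subst ht; simp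
        · abel
      simp only [MatSeq.residual, MatSeq.kkt, hsh, this, Matrix.zero_mulVec]
      rfl
    · rw [hres.mult]
      have : B * (-K * F ^ t) + A * (if t = 0 then 0 else F ^ t) - F * F ^ t +
          (if t = 0 then A else 0) = 0 := by
        have h2 : F * F ^ t = A * F ^ t - B * (K * F ^ t) := by
          conv_lhs => rw [hF, Matrix.sub_mul, Matrix.mul_assoc]
        rw [h2]
        split_ifs with ht
        · subst ht
          simp only [pow_zero, Matrix.mul_one, Matrix.mul_zero, Matrix.mul_neg]
          abel
        · simp only [Matrix.neg_mul, Matrix.mul_neg]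
          abel
      simp only [MatSeq.residual, MatSeq.kkt, hsh, this, Matrix.zero_mulVec]
      rfl
  · have hFn : ‖F‖ ≤ τ := by
      have h1 := hstab 1
      rw [pow_one] at h1
      refine h1.trans (mul_le_of_le_one_right hτ0 ?_)
      rw [Real.exp_le_one_iff]
      simpa using hρ.le
    have hPn := norm_lyap_le hρ hstab (gainCost Q R S K)
    rw [← hP] at hPn
    have hGn : ‖gainCost Q R S K‖ ≤ ‖Q‖ + 2 * ‖S‖ * ‖K‖ + ‖R‖ * ‖K‖ ^ 2 := by
      have h1 : ‖Sᵀ * K‖ ≤ ‖S‖ * ‖K‖ := by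
        rw [← norm_transpose_eq S]; exact Matrix.l2_opNorm_mul _ _
      have h2 : ‖Kᵀ * S‖ ≤ ‖K‖ * ‖S‖ := by
        rw [← norm_transpose_eq K]; exact Matrix.l2_opNorm_mul _ _
      have h3 : ‖Kᵀ * R * K‖ ≤ ‖K‖ * ‖R‖ * ‖K‖ := by
        conv_rhs => rw [← norm_transpose_eq K]
        rw [norm_transpose_eq]
        refine (Matrix.l2_opNorm_mul _ _).trans ?_
        gcongr
        rw [← norm_transpose_eq K]
        exact Matrix.l2_opNorm_mul _ _
      have h4 := norm_add_le_of_le (norm_sub_le_of_le (norm_sub_le_of_le (le_refl ‖Q‖) h1) h2) h3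
      rw [gainCost]
      linarith
    set g := 1 / (1 - Real.exp (-2 * ρ)) with hgdef
    have hg : 0 ≤ g := by
      have := exp_neg_two_mul_lt_one hρ
      rw [hgdef]
      exact div_nonneg zero_le_one (by linarith)
    have hPF : ‖P * F‖ ≤ τ ^ 3 * g * (‖Q‖ + 2 * ‖S‖ * ‖K‖ + ‖R‖ * ‖K‖ ^ 2) := by
      calc _ ≤ ‖P‖ * ‖F‖ := Matrix.l2_opNorm_mul _ _
        _ ≤ (τ ^ 2 * g * (‖Q‖ + 2 * ‖S‖ * ‖K‖ + ‖R‖ * ‖K‖ ^ 2)) * τ := by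
          gcongr
          exact hPn.trans (by gcongr)
        _ = _ := by ring
    have hz := norm_le_add (KKTSpace.mk x u p)
    simp only [st_mk, ctl_mk, mult_mk] at hz
    rw [norm_neg] at hun
    refine hz.trans ((add_le_add (add_le_add hxn hun) hpn).trans ?_)
    rw [trajConst, ← add_mul, ← add_mul, ← add_mul, ← add_mul]
    rw [mul_comm (τ * g)]
    gcongr

lemma norm_matrix_le_of_mulVec {m n : Type*} [Fintype m] [Fintype n] [DecidableEq n]
    {X : Matrix m n ℝ} {C : ℝ} (hC : 0 ≤ C)
    (h : ∀ x : n → ℝ, ‖WithLp.toLp 2 (X *ᵥ x)‖ ≤ C * ‖WithLp.toLp 2 x‖) : ‖X‖ ≤ C := by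
  rw [Matrix.l2_opNorm_def]
  refine ContinuousLinearMap.opNorm_le_bound _ hC fun x => ?_
  exact h (WithLp.ofLp x)

end Iteration

/-! ### Spatial decay -/

section SED

variable {N : ℕ} {d : Fin N → Fin N → ℝ} {l m n : Fin N → ℕ} {γ c c' : ℝ}

lemma norm_block_le (X : Matrix (Idx m) (Idx n) ℝ) (i j : Fin N) : ‖block X i j‖ ≤ ‖X‖ := by
  refine norm_matrix_le_of_mulVec (norm_nonneg _) fun v => ?_
  -- extend `v` by zero to the other agents
  let v' : Idx n → ℝ := fun p => if h : p.1 = j then v (h ▸ p.2) else 0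
  have hv' : ∀ k (q : Fin (n k)), v' ⟨k, q⟩ = if h : k = j then v (h ▸ q) else 0 := fun _ _ => rfl
  have h1 : ‖WithLp.toLp 2 v'‖ = ‖WithLp.toLp 2 v‖ := by
    rw [← sq_eq_sq₀ (norm_nonneg _) (norm_nonneg _), ← dotProduct_self_eq_norm_sq,
      ← dotProduct_self_eq_norm_sq]
    simp only [dotProduct]
    rw [Fintype.sum_sigma, Finset.sum_eq_single j]
    · simp [hv']
    · intro k _ hk; simp [hv', hk]
    · simp
  have h2 : ∀ p, (block X i j *ᵥ v) p = (X *ᵥ v') ⟨i, p⟩ := by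
    intro p
    simp only [Matrix.mulVec, dotProduct]
    rw [Fintype.sum_sigma, Finset.sum_eq_single j]
    · simp [hv', block]
    · intro k _ hk; simp [hv', hk]
    · simp
  have h3 : ‖WithLp.toLp 2 (block X i j *ᵥ v)‖ ≤ ‖WithLp.toLp 2 (X *ᵥ v')‖ := by
    refine le_of_sq_le_sq ?_ (norm_nonneg _)
    rw [← dotProduct_self_eq_norm_sq, ← dotProduct_self_eq_norm_sq]
    simp only [dotProduct, h2]
    rw [Fintype.sum_sigma (f := fun p : Idx m => (X *ᵥ v') p * (X *ᵥ v') p)]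
    exact Finset.single_le_sum (f := fun i => ∑ p : Fin (m i), (X *ᵥ v') ⟨i, p⟩ * (X *ᵥ v') ⟨i, p⟩)
      (fun k _ => Finset.sum_nonneg fun p _ => mul_self_nonneg _) (Finset.mem_univ i)
  exact h3.trans ((norm_toLp_mulVec_le X v').trans_eq (by rw [h1]))

lemma block_mul (X : Matrix (Idx l) (Idx m) ℝ) (Y : Matrix (Idx m) (Idx n) ℝ) (i j : Fin N) :
    block (X * Y) i j = ∑ k, block X i k * block Y k j := by
  ext p q
  simp only [block, Matrix.submatrix_apply, Matrix.mul_apply, Matrix.sum_apply, Fintype.sum_sigma]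

lemma isSED_zero (hc : 0 ≤ c) : IsSED d c γ (0 : Matrix (Idx m) (Idx n) ℝ) := fun i j => by
  have : block (0 : Matrix (Idx m) (Idx n) ℝ) i j = 0 := rfl
  rw [this, norm_zero]
  positivity

lemma IsSED.mono {X : Matrix (Idx m) (Idx n) ℝ} (h : IsSED d c γ X) (hc : c ≤ c') :
    IsSED d c' γ X :=
  fun i j => (h i j).trans (by gcongr)

lemma IsSED.add {X Y : Matrix (Idx m) (Idx n) ℝ} (hX : IsSED d c γ X) (hY : IsSED d c' γ Y) :
    IsSED d (c + c') γ (X + Y) := fun i j => by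
  rw [add_mul]
  exact norm_add_le_of_le (hX i j) (hY i j)

lemma IsSED.sub {X Y : Matrix (Idx m) (Idx n) ℝ} (hX : IsSED d c γ X) (hY : IsSED d c' γ Y) :
    IsSED d (c + c') γ (X - Y) := fun i j => by
  rw [add_mul]
  exact norm_sub_le_of_le (hX i j) (hY i j)

lemma IsSED.smul_of_le_one {X : Matrix (Idx m) (Idx n) ℝ} (hX : IsSED d c γ X) {η : ℝ}
    (h0 : 0 ≤ η) (h1 : η ≤ 1) : IsSED d c γ (η • X) := fun i j => by
  have : block (η • X) i j = η • block X i j := rfl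
  rw [this, norm_smul, Real.norm_of_nonneg h0]
  exact (mul_le_of_le_one_left (norm_nonneg _) h1).trans (hX i j)

lemma IsSED.transpose (hd : IsDistance d) {X : Matrix (Idx m) (Idx n) ℝ} (hX : IsSED d c γ X) :
    IsSED d c γ Xᵀ := fun i j => by
  have : block Xᵀ i j = (block X j i)ᵀ := rfl
  rw [this, norm_transpose_eq, hd.symm]
  exact hX j i

lemma IsSED.mul (hd : IsDistance d) (hγ : 0 ≤ γ) (hc : 0 ≤ c) (hc' : 0 ≤ c')
    {X : Matrix (Idx l) (Idx m) ℝ} {Y : Matrix (Idx m) (Idx n) ℝ} (hX : IsSED d c γ X)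
    (hY : IsSED d c' γ Y) : IsSED d (N * c * c') γ (X * Y) := fun i j => by
  rw [block_mul]
  have h : ∀ k ∈ Finset.univ, ‖block X i k * block Y k j‖ ≤ c * c' * Real.exp (-γ * d i j) := by
    intro k _
    calc _ ≤ ‖block X i k‖ * ‖block Y k j‖ := Matrix.l2_opNorm_mul _ _
      _ ≤ (c * Real.exp (-γ * d i k)) * (c' * Real.exp (-γ * d k j)) := by
        gcongr
        exacts [hX i k, hY k j]
      _ = c * c' * Real.exp (-γ * (d i k + d k j)) := by
        rw [mul_add, Real.exp_add]; ring
      _ ≤ _ := by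
        have := mul_le_mul_of_nonneg_left (hd.triangle i j k) hγ
        refine mul_le_mul_of_nonneg_left (Real.exp_le_exp.mpr ?_) (by positivity)
        linarith
  refine (norm_sum_le_of_le _ h).trans (le_of_eq ?_)
  simp [mul_assoc]

/-- All three components of a matrix sequence are spatially exponentially decaying, uniformly in
time. -/
structure MatSeq.IsSED (d : Fin N → Fin N → ℝ) {nx nu : Fin N → ℕ} (c γ : ℝ)
    (V : MatSeq (Idx nx) (Idx nu)) : Prop where
  st : ∀ t, NetworkLQR.IsSED d c γ (V.st t)
  ctl : ∀ t, NetworkLQR.IsSED d c γ (V.ctl t)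
  mult : ∀ t, NetworkLQR.IsSED d c γ (V.mult t)

variable {nx nu : Fin N → ℕ} {A : Matrix (Idx nx) (Idx nx) ℝ} {B : Matrix (Idx nx) (Idx nu) ℝ}
  {Q : Matrix (Idx nx) (Idx nx) ℝ} {R : Matrix (Idx nu) (Idx nu) ℝ}
  {S : Matrix (Idx nu) (Idx nx) ℝ} {a b q r s : ℝ} {V : MatSeq (Idx nx) (Idx nu)}

/-- The factor by which one application of the KKT operator increases the decay constant. -/
def growth (N a b q r s : ℝ) : ℝ := 1 + N * (a + b + q + r + s)

lemma MatSeq.IsSED.kkt (hd : IsDistance d) (hγ : 0 ≤ γ) (ha : 0 ≤ a) (hb : 0 ≤ b) (hq : 0 ≤ q)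
    (hr : 0 ≤ r) (hs : 0 ≤ s) (hA : NetworkLQR.IsSED d a γ A) (hB : NetworkLQR.IsSED d b γ B)
    (hQ : NetworkLQR.IsSED d q γ Q) (hR : NetworkLQR.IsSED d r γ R)
    (hS : NetworkLQR.IsSED d s γ S) (hc : 0 ≤ c) (hV : V.IsSED d c γ) :
    (V.kkt A B Q R S).IsSED d (growth N a b q r s * c) γ := by
  have hN : (0 : ℝ) ≤ N := Nat.cast_nonneg N
  have hAT := hA.transpose hd
  have hBT := hB.transpose hd
  have hST := hS.transpose hd
  have hsh : ∀ t, NetworkLQR.IsSED d c γ (rightShift V.st t) := by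
    intro t
    cases t with
    | zero => exact isSED_zero hc
    | succ t => exact hV.st t
  have na : 0 ≤ N * a * c := by positivity
  have nb : 0 ≤ N * b * c := by positivity
  have nq : 0 ≤ N * q * c := by positivity
  have nr : 0 ≤ N * r * c := by positivity
  have ns : 0 ≤ N * s * c := by positivity
  refine ⟨fun t => ?_, fun t => ?_, fun t => ?_⟩
  · refine ((((hQ.mul hd hγ hq hc (hV.st t)).add (hST.mul hd hγ hs hc (hV.ctl _))).add
      (hAT.mul hd hγ ha hc (hV.mult _))).sub (hV.mult t)).mono ?_
    rw [growth]; linarith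
  · refine (((hR.mul hd hγ hr hc (hV.ctl t)).add (hS.mul hd hγ hs hc (hsh t))).add
      (hBT.mul hd hγ hb hc (hV.mult t))).mono ?_
    rw [growth]; linarith
  · refine (((hB.mul hd hγ hb hc (hV.ctl t)).add (hA.mul hd hγ ha hc (hsh t))).sub
      (hV.st t)).mono ?_
    rw [growth]; linarith

/-- After `k` steps of gradient descent the iterates decay with the rate of the data and a constant
that is at most exponential in `k`. -/
lemma MatSeq.isSED_iter (hd : IsDistance d) (hγ : 0 ≤ γ) (ha : 0 ≤ a) (hb : 0 ≤ b) (hq : 0 ≤ q)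
    (hr : 0 ≤ r) (hs : 0 ≤ s) (hA : NetworkLQR.IsSED d a γ A) (hB : NetworkLQR.IsSED d b γ B)
    (hQ : NetworkLQR.IsSED d q γ Q) (hR : NetworkLQR.IsSED d r γ R)
    (hS : NetworkLQR.IsSED d s γ S) (hN : (1 : ℝ) ≤ N) {η : ℝ} (h0 : 0 ≤ η) (h1 : η ≤ 1)
    (k : ℕ) :
    (MatSeq.iter A B Q R S η k).IsSED d ((1 + growth N a b q r s ^ 2) ^ k - 1) γ := by
  set g := growth N a b q r s with hg
  have hNs : (a + b + q + r + s) ≤ N * (a + b + q + r + s) :=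
    le_mul_of_one_le_left (by positivity) hN
  have hg0 : 0 ≤ g := by rw [hg, growth]; positivity
  have hga : a ≤ g := by rw [hg, growth]; linarith
  have hgs : s ≤ g := by rw [hg, growth]; linarith
  induction k with
  | zero =>
    refine ⟨fun t => ?_, fun t => ?_, fun t => ?_⟩ <;> exact isSED_zero (by simp)
  | succ k ih =>
    set c := (1 + g ^ 2) ^ k - 1 with hc
    have hc0 : 0 ≤ c := sub_nonneg.mpr (one_le_pow₀ (by nlinarith [sq_nonneg g]))
    have hkkt : ∀ {c : ℝ} {V : MatSeq (Idx nx) (Idx nu)}, 0 ≤ c → V.IsSED d c γ →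
        (V.kkt A B Q R S).IsSED d (g * c) γ := fun h =>
      MatSeq.IsSED.kkt hd hγ ha hb hq hr hs hA hB hQ hR hS h
    have h2 := hkkt hc0 ih
    have himp : ∀ {c : ℝ} {m n : Fin N → ℕ} {X : Matrix (Idx m) (Idx n) ℝ} (t : ℕ), 0 ≤ c →
        NetworkLQR.IsSED d c γ X → NetworkLQR.IsSED d c γ (if t = 0 then X else 0) := by
      intro c m n X t hc hX
      split_ifs
      exacts [hX, isSED_zero hc]
    have h3 : ((MatSeq.iter A B Q R S η k).residual A B Q R S).IsSED d (g * c + g) γ :=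
      ⟨fun t => (h2.st t).mono (by linarith),
        fun t => (h2.ctl t).add (himp t hg0 (hS.mono hgs)),
        fun t => (h2.mult t).add (himp t hg0 (hA.mono hga))⟩
    have h4 := hkkt (by positivity) h3
    have e : (1 + g ^ 2) ^ (k + 1) - 1 = c + g * (g * c + g) := by rw [hc]; ring
    rw [e]
    exact ⟨fun t => (ih.st t).sub ((h4.st t).smul_of_le_one h0 h1),
      fun t => (ih.ctl t).sub ((h4.ctl t).smul_of_le_one h0 h1),
      fun t => (ih.mult t).sub ((h4.mult t).smul_of_le_one h0 h1)⟩

lemma growth_le (hN : (1 : ℝ) ≤ N) (ha : 1 ≤ a) (hb : 1 ≤ b) (hq : 1 ≤ q) (hr : 1 ≤ r)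
    (hs : 0 ≤ s) : growth N a b q r s ≤ 6 * (N * a * b * q * r * (1 + s)) := by
  have h1 : 1 ≤ 1 + s := by linarith
  have hle : ∀ {x y : ℝ}, 1 ≤ x → 1 ≤ y → x ≤ x * y := fun hx hy =>
    le_mul_of_one_le_right (by linarith) hy
  have m := fun {x y : ℝ} (hx : 1 ≤ x) (hy : 1 ≤ y) => one_le_mul_of_one_le_of_one_le hx hy
  have pa : a ≤ a * (b * q * r * (1 + s)) := hle ha (m (m (m hb hq) hr) h1)
  have pb : b ≤ b * (a * q * r * (1 + s)) := hle hb (m (m (m ha hq) hr) h1)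
  have pq : q ≤ q * (a * b * r * (1 + s)) := hle hq (m (m (m ha hb) hr) h1)
  have pr : r ≤ r * (a * b * q * (1 + s)) := hle hr (m (m (m ha hb) hq) h1)
  have ps : 1 + s ≤ (1 + s) * (a * b * q * r) := hle h1 (m (m (m ha hb) hq) hr)
  have pN : (1 : ℝ) ≤ N * (a * b * q * r * (1 + s)) := m hN (m (m (m (m ha hb) hq) hr) h1)
  have hsum : a + b + q + r + s ≤ 5 * (a * b * q * r * (1 + s)) := by linarith
  have := mul_le_mul_of_nonneg_left hsum (by linarith : (0 : ℝ) ≤ N)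
  rw [growth]
  linarith

/-- The number of agents and the decay constants of the data enter the growth per step of the
iteration only through a sum of logarithms. -/
lemma log_growth_le (hN : (1 : ℝ) ≤ N) (ha : 1 ≤ a) (hb : 1 ≤ b) (hq : 1 ≤ q) (hr : 1 ≤ r)
    (hs : 0 ≤ s) : Real.log (1 + growth N a b q r s ^ 2) ≤
      72 + 2 * (Real.log N + Real.log a + Real.log b + Real.log q + Real.log r +
        Real.log (1 + s)) := by
  have h1 := growth_le hN ha hb hq hr hs
  have h2 : 1 ≤ growth N a b q r s := by
    rw [growth]
    have : (0 : ℝ) ≤ N * (a + b + q + r + s) := by positivity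
    linarith
  have h3 : 1 + growth N a b q r s ^ 2 ≤ 72 * (N * a * b * q * r * (1 + s)) ^ 2 := by nlinarith
  have p1 : (N : ℝ) ≠ 0 := by positivity
  have p2 : a ≠ 0 := by positivity
  have p3 : b ≠ 0 := by positivity
  have p4 : q ≠ 0 := by positivity
  have p5 : r ≠ 0 := by positivity
  have p6 : 1 + s ≠ 0 := by positivity
  refine (Real.log_le_log (by positivity) h3).trans ?_
  rw [Real.log_mul (by norm_num) (by positivity), Real.log_pow, Real.log_mul (by positivity) p6,
    Real.log_mul (by positivity) p5, Real.log_mul (by positivity) p4,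
    Real.log_mul (by positivity) p3, Real.log_mul p1 p2]
  have := Real.log_le_sub_one_of_pos (show (0 : ℝ) < 72 by norm_num)
  push_cast
  linarith

end SED

section Interpolation

/-- Choosing the number of steps proportional to the distance balances the error `C e^{-αk}` of the
iteration against the growth `M^k` of its decay constant. -/
lemma le_of_forall_le_exp_add_pow {v C α M y θ : ℝ} (hC : 0 ≤ C) (hα : 0 < α) (hα1 : α ≤ 1)
    (hM : 1 ≤ M) (hy : 0 ≤ y) (hθ : θ * (α + Real.log M) ≤ α)
    (h : ∀ k : ℕ, v ≤ C * Real.exp (-α * k) + M ^ k * Real.exp (-y)) :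
    v ≤ (3 * C + 1) * Real.exp (-(θ * y)) := by
  have hlog := Real.log_nonneg hM
  have hpos : 0 < α + Real.log M := by linarith
  set k := ⌊y / (α + Real.log M)⌋₊ with hk
  have hk1 : (k : ℝ) * (α + Real.log M) ≤ y := by
    rw [← le_div_iff₀ hpos]; exact Nat.floor_le (by positivity)
  have hk2 : y ≤ (k + 1) * (α + Real.log M) := by
    rw [← div_le_iff₀ hpos]; exact (Nat.lt_floor_add_one _).le
  have hθy : θ * y ≤ α * k + α := by
    rcases le_or_gt θ 0 with h0 | h0
    · have : θ * y ≤ 0 := mul_nonpos_of_nonpos_of_nonneg h0 hy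
      have : 0 ≤ α * k := by positivity
      linarith
    · have := mul_le_mul_of_nonneg_left hk2 h0.le
      have h2 : ((k : ℝ) + 1) * (θ * (α + Real.log M)) ≤ (k + 1) * α := by gcongr
      linarith
  have h1 : Real.exp (-α * k) ≤ 3 * Real.exp (-(θ * y)) := by
    have h3 : Real.exp (-α * k) ≤ Real.exp 1 * Real.exp (-(θ * y)) := by
      rw [← Real.exp_add]
      gcongr
      linarith
    refine h3.trans ?_
    gcongr
    exact Real.exp_one_lt_three.le
  have h2 : M ^ k * Real.exp (-y) ≤ Real.exp (-(θ * y)) := by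
    have e : M ^ k = Real.exp (k * Real.log M) := by
      rw [Real.exp_nat_mul, Real.exp_log (by linarith)]
    rw [e, ← Real.exp_add]
    gcongr
    -- `k log M ≤ y log M / (α + log M)`, and `log M / (α + log M) ≤ 1 - θ`
    have h3 : (k * Real.log M) * (α + Real.log M) ≤ (y - θ * y) * (α + Real.log M) := by
      have h4 := mul_le_mul_of_nonneg_left hk1 hlog
      have h5 := mul_le_mul_of_nonneg_left hθ hy
      linarith
    have := le_of_mul_le_mul_right h3 hpos
    linarith
  calc v ≤ C * Real.exp (-α * k) + M ^ k * Real.exp (-y) := h k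
    _ ≤ C * (3 * Real.exp (-(θ * y))) + Real.exp (-(θ * y)) := by gcongr
    _ = _ := by ring

end Interpolation

section Constants

variable {α : Type*} [CommSemiring α]

/-- The factor by which the decay rate of the gain is smaller than that of the data. Here `g` stands
for `1 / (1 - e^{-2ρ})`, `lS`, `lQ` for the inverses of the least eigenvalues, `nB, …, nS` for the
norms, `k` for `‖K₀‖²`, and `e` for the sum of the logarithms. -/
def decayDenom (τ g lS lQ nB nQ nR nS k e : α) : α :=
  1 + 2 * kktInv (formConst lS lQ nS) (2 * τ * g) (1 + k) nQ nR nS ^ 2 *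
    kktNorm τ (1 + k) nB nQ nR nS ^ 2 * (72 + 2 * e)

/-- The decay constant of the gain. -/
def decayConst (τ g nQ nR nS nK : α) : α := 3 * trajConst τ g nQ nR nS nK + 1

lemma map_decayDenom {β : Type*} [CommSemiring β] (f : α →+* β) (τ g lS lQ nB nQ nR nS k e : α) :
    f (decayDenom τ g lS lQ nB nQ nR nS k e) =
      decayDenom (f τ) (f g) (f lS) (f lQ) (f nB) (f nQ) (f nR) (f nS) (f k) (f e) := by
  simp [decayDenom, kktInv, formConst, kktNorm, map_ofNat]

lemma map_decayConst {β : Type*} [CommSemiring β] (f : α →+* β) (τ g nQ nR nS nK : α) :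
    f (decayConst τ g nQ nR nS nK) =
      decayConst (f τ) (f g) (f nQ) (f nR) (f nS) (f nK) := by
  simp [decayConst, trajConst, map_ofNat]

lemma one_le_decayDenom {τ g lS lQ nB nQ nR nS k e : ℝ} (h1 : 0 ≤ τ) (h2 : 0 ≤ g) (h3 : 0 ≤ lS)
    (h4 : 0 ≤ lQ) (h5 : 0 ≤ nB) (h6 : 0 ≤ nQ) (h7 : 0 ≤ nR) (h8 : 0 ≤ nS) (h9 : 0 ≤ k)
    (h10 : 0 ≤ e) : 1 ≤ decayDenom τ g lS lQ nB nQ nR nS k e := by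
  unfold decayDenom kktInv formConst kktNorm
  exact le_add_of_nonneg_right (by positivity)

lemma lamMin_nonneg {n : Type*} [Fintype n] [DecidableEq n] {Q : Matrix n n ℝ} (hQ : Q.PosDef) :
    0 ≤ lamMin Q := by
  rcases isEmpty_or_nonempty n with h | h
  · rw [lamMin, spectrum.of_subsingleton, Real.sInf_empty]
  · exact (lamMin_pos hQ).le

end Constants

section Gain

variable {N : ℕ} {d : Fin N → Fin N → ℝ} {nx nu : Fin N → ℕ}

lemma norm_block_eq_zero {m n : Fin N → ℕ} (h : IsEmpty (Idx m) ∨ IsEmpty (Idx n))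
    (X : Matrix (Idx m) (Idx n) ℝ) (i j : Fin N) : ‖block X i j‖ = 0 := by
  have : block X i j = 0 := by
    ext p q
    rcases h with h | h
    · exact (h.false ⟨i, p⟩).elim
    · exact (h.false ⟨j, q⟩).elim
  rw [this, norm_zero]

/-- The deterministic core: a stabilizing gain that solves the Riccati equation decays in space. Up
to a sign, it is the control component, at time `0`, of the solution of the optimality system. -/
lemma isSED_of_riccati (hd : IsDistance d) {A : Matrix (Idx nx) (Idx nx) ℝ}
    {B : Matrix (Idx nx) (Idx nu) ℝ} {Q : Matrix (Idx nx) (Idx nx) ℝ}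
    {R : Matrix (Idx nu) (Idx nu) ℝ} {S : Matrix (Idx nu) (Idx nx) ℝ} (hQ : Q.PosDef)
    (hR : (R - S * Q⁻¹ * Sᵀ).PosDef) {γ a b q r s : ℝ} (hγ : 0 ≤ γ) (ha : 1 ≤ a) (hb : 1 ≤ b)
    (hq : 1 ≤ q) (hr : 1 ≤ r) (hs : 0 ≤ s) (hA : IsSED d a γ A) (hB : IsSED d b γ B)
    (hQs : IsSED d q γ Q) (hRs : IsSED d r γ R) (hSs : IsSED d s γ S) {τ ρ : ℝ} (hτ : 1 ≤ τ)
    (hρ : 0 < ρ) {K₀ K : Matrix (Idx nu) (Idx nx) ℝ} (hK₀ : IsExpStable τ ρ (A - B * K₀))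
    (hric : (R + Bᵀ * lyap (A - B * K) (gainCost Q R S K) * B) * K =
      Bᵀ * lyap (A - B * K) (gainCost Q R S K) * A + S) (hK : IsExpStable τ ρ (A - B * K)) :
    IsSED d (decayConst τ (1 / (1 - Real.exp (-2 * ρ))) ‖Q‖ ‖R‖ ‖S‖ ‖K‖)
      (γ * ρ / ((1 + ρ) * decayDenom τ (1 / (1 - Real.exp (-2 * ρ)))
        (1 / lamMin (R - S * Q⁻¹ * Sᵀ)) (1 / lamMin Q) ‖B‖ ‖Q‖ ‖R‖ ‖S‖ (‖K₀‖ ^ 2)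
        (Real.log N + Real.log a + Real.log b + Real.log q + Real.log r +
          Real.log (1 + s)))) K := by
  intro i j
  have hτ0 : 0 ≤ τ := by linarith
  have hexp2 := exp_neg_two_mul_lt_one hρ
  have hg0 : 0 ≤ 1 / (1 - Real.exp (-2 * ρ)) := div_nonneg zero_le_one (by linarith)
  -- `1 / (1 - e^{-ρ}) = (1 + e^{-ρ}) / (1 - e^{-2ρ})`
  have hΘ : τ / (1 - Real.exp (-ρ)) ≤ 2 * τ * (1 / (1 - Real.exp (-2 * ρ))) := by
    have h1 : Real.exp (-ρ) < 1 := Real.exp_zero ▸ Real.exp_lt_exp.mpr (by linarith)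
    have h2 : Real.exp (-2 * ρ) = Real.exp (-ρ) ^ 2 := by
      rw [← Real.exp_nat_mul]; congr 1; push_cast; ring
    have h3 := Real.exp_pos (-ρ)
    rw [h2] at hexp2 ⊢
    rw [mul_one_div, div_le_div_iff₀ (by linarith) (by linarith)]
    nlinarith [mul_nonneg hτ0 (mul_nonneg (sub_nonneg.mpr h1.le) (sub_nonneg.mpr h1.le))]
  set g := 1 / (1 - Real.exp (-2 * ρ)) with hg
  have hC0 : 0 ≤ trajConst τ g ‖Q‖ ‖R‖ ‖S‖ ‖K‖ := by unfold trajConst; positivity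
  -- a matrix without rows or columns is zero; the spectral bounds below need nonempty index types
  rcases isEmpty_or_nonempty (Idx nu) with hu | hu
  · rw [norm_block_eq_zero (Or.inl hu), decayConst]; positivity
  rcases isEmpty_or_nonempty (Idx nx) with hx | hx
  · rw [norm_block_eq_zero (Or.inr hx), decayConst]; positivity
  have hN : (1 : ℝ) ≤ N := by exact_mod_cast i.pos
  have hlS := lamMin_nonneg hR
  have hlQ := lamMin_nonneg hQ
  have hk : ‖K₀‖ ≤ 1 + ‖K₀‖ ^ 2 := by nlinarith [sq_nonneg (‖K₀‖ - 1), norm_nonneg K₀]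
  have hAn : ‖A‖ ≤ τ + ‖B‖ * (1 + ‖K₀‖ ^ 2) := by
    have h1 : A = (A - B * K₀) ^ 1 + B * K₀ := by rw [pow_one]; abel
    have h2 : ‖(A - B * K₀) ^ 1‖ ≤ τ := by
      refine (hK₀ 1).trans (mul_le_of_le_one_right hτ0 ?_)
      rw [Real.exp_le_one_iff]
      simpa using hρ.le
    calc ‖A‖ = ‖(A - B * K₀) ^ 1 + B * K₀‖ := by rw [← h1]
      _ ≤ τ + ‖B‖ * ‖K₀‖ := norm_add_le_of_le h2 (Matrix.l2_opNorm_mul _ _)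
      _ ≤ _ := by gcongr
  set w := formConst (1 / lamMin (R - S * Q⁻¹ * Sᵀ)) (1 / lamMin Q) ‖S‖ with hw
  have hw0 : 0 ≤ w := by rw [hw]; unfold formConst; positivity
  set L := kktNorm τ (1 + ‖K₀‖ ^ 2) ‖B‖ ‖Q‖ ‖R‖ ‖S‖ with hL
  set κ := kktInv w (2 * τ * g) (1 + ‖K₀‖ ^ 2) ‖Q‖ ‖R‖ ‖S‖ with hκ
  have hL1 : 1 ≤ L := by
    have : 0 ≤ 3 * (‖Q‖ + ‖R‖ + ‖S‖ + ‖B‖ + τ + ‖B‖ * (1 + ‖K₀‖ ^ 2)) := by positivity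
    rw [hL, kktNorm]; linarith
  have hκ1 : 1 ≤ κ := by
    rw [hκ, kktInv]
    refine one_le_mul_of_one_le_of_one_le ?_ ?_
    · have : 0 ≤ 2 * τ * g * (1 + (1 + ‖K₀‖ ^ 2)) * (1 + ‖Q‖ + ‖R‖ + ‖S‖) := by positivity
      linarith
    · have : 0 ≤ w * (2 + 2 * τ * g * (1 + (1 + ‖K₀‖ ^ 2)) * (1 + ‖Q‖ + ‖R‖ + ‖S‖)) := by
        positivity
      linarith
  have hη : 1 / L ^ 2 ≤ 1 := by
    rw [div_le_one (by positivity)]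
    exact one_le_pow₀ hL1
  set M := 1 + growth N a b q r s ^ 2 with hM
  set E := Real.log N + Real.log a + Real.log b + Real.log q + Real.log r + Real.log (1 + s)
  have hlogM : Real.log M ≤ 72 + 2 * E := log_growth_le hN ha hb hq hr hs
  have hα : 0 < 1 / (2 * κ ^ 2 * L ^ 2) := by positivity
  have hα1 : 1 / (2 * κ ^ 2 * L ^ 2) ≤ 1 := by
    rw [div_le_one (by positivity)]
    have := one_le_mul_of_one_le_of_one_le (one_le_pow₀ hκ1 (n := 2)) (one_le_pow₀ hL1 (n := 2))
    linarith
  have hiter : ∀ k : ℕ, ‖block K i j‖ ≤ trajConst τ g ‖Q‖ ‖R‖ ‖S‖ ‖K‖ *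
      Real.exp (-(1 / (2 * κ ^ 2 * L ^ 2)) * k) + M ^ k * Real.exp (-(γ * d i j)) := by
    intro k
    set U := (MatSeq.iter A B Q R S (1 / L ^ 2) k).ctl 0 with hU
    have hUs := (MatSeq.isSED_iter hd hγ (by linarith) (by linarith) (by linarith) (by linarith) hs
      hA hB hQs hRs hSs hN (by positivity) hη k).ctl 0 i j
    rw [← hU, ← hM, neg_mul] at hUs
    have hUK : ‖U + K‖ ≤ trajConst τ g ‖Q‖ ‖R‖ ‖S‖ ‖K‖ *
        Real.exp (-(1 / (2 * κ ^ 2 * L ^ 2)) * k) := by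
      refine norm_matrix_le_of_mulVec (by positivity) fun x₀ => ?_
      obtain ⟨z', hz', hz0, hzn⟩ := exists_optimal_trajectory hρ hτ hK hric x₀
      obtain ⟨z, hz, hzz⟩ := exists_represents_iter (transpose_eq_of_posDef hQ)
        (transpose_eq_of_schur hQ hR) (by linarith) (by linarith)
        (norm_kkt_le A B S hAn)
        (norm_le_kktInv_mul A B S hρ hK₀ hΘ (by positivity) hk hw0
          (dotProduct_add_le_stageCost hQ hR)) hz' k
      have h1 : (U + K) *ᵥ x₀ = SeqSpace.coord (KKTSpace.ctl (z - z')) 0 := by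
        rw [KKTSpace.ctl_sub, SeqSpace.coord_sub, hz.ctl, hz0, Matrix.add_mulVec, sub_neg_eq_add]
      have h2 : ‖WithLp.toLp 2 ((U + K) *ᵥ x₀)‖ ≤ ‖z - z'‖ := by
        refine le_trans (le_of_sq_le_sq ?_ (norm_nonneg _)) (KKTSpace.norm_ctl_le (z - z'))
        rw [← dotProduct_self_eq_norm_sq, h1]
        exact SeqSpace.coord_dotProduct_self_le _ 0
      calc _ ≤ Real.exp (-(1 / (2 * κ ^ 2 * L ^ 2)) * k) * ‖z'‖ := h2.trans hzz
        _ ≤ Real.exp (-(1 / (2 * κ ^ 2 * L ^ 2)) * k) *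
            (trajConst τ g ‖Q‖ ‖R‖ ‖S‖ ‖K‖ * ‖WithLp.toLp 2 x₀‖) := by gcongr
        _ = _ := by ring
    have h3 : block K i j = block (U + K) i j - block U i j := by
      ext p p'; simp [block]
    rw [h3]
    refine norm_sub_le_of_le ((norm_block_le _ i j).trans hUK) (hUs.trans ?_)
    gcongr
    linarith
  have hy : 0 ≤ γ * d i j := mul_nonneg hγ (hd.nonneg i j)
  have hM1 : 1 ≤ M := by rw [hM]; nlinarith [sq_nonneg (growth N a b q r s)]
  set D := decayDenom τ g (1 / lamMin (R - S * Q⁻¹ * Sᵀ)) (1 / lamMin Q) ‖B‖ ‖Q‖ ‖R‖ ‖S‖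
    (‖K₀‖ ^ 2) E with hD
  have hDeq : D = 1 + 2 * κ ^ 2 * L ^ 2 * (72 + 2 * E) := rfl
  have hD0 : 0 < D := by
    have h1 := Real.log_nonneg hM1
    have : 0 ≤ 2 * κ ^ 2 * L ^ 2 * (72 + 2 * E) := by
      refine mul_nonneg (by positivity) (h1.trans hlogM)
    linarith
  have hθ : ρ / ((1 + ρ) * D) * (1 / (2 * κ ^ 2 * L ^ 2) + Real.log M) ≤
      1 / (2 * κ ^ 2 * L ^ 2) := by
    have h1 : 1 / (2 * κ ^ 2 * L ^ 2) + Real.log M ≤ 1 / (2 * κ ^ 2 * L ^ 2) * D := by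
      rw [hDeq]
      refine (add_le_add_right hlogM _).trans (le_of_eq ?_)
      field_simp
    calc _ ≤ ρ / ((1 + ρ) * D) * (1 / (2 * κ ^ 2 * L ^ 2) * D) := by gcongr
      _ = ρ / (1 + ρ) * (1 / (2 * κ ^ 2 * L ^ 2)) := by field_simp
      _ ≤ _ := mul_le_of_le_one_left hα.le (by rw [div_le_one (by linarith)]; linarith)
  have hfin := le_of_forall_le_exp_add_pow hC0 hα hα1 hM1 hy hθ hiter
  refine hfin.trans (le_of_eq ?_)
  rw [decayConst]
  congr 2
  ring

end Gain

end NetworkLQR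

theorem corollary1 :
    ∃ (Pc : MvPolynomial (Fin 16) ℝ) (Pγ : MvPolynomial (Fin 18) ℝ),
    ∀ (N : ℕ) (d : Fin N → Fin N → ℝ) (_ : NetworkLQR.IsDistance d)
      (nx nu : Fin N → ℕ)
      (A : Matrix (NetworkLQR.Idx nx) (NetworkLQR.Idx nx) ℝ)
      (B : Matrix (NetworkLQR.Idx nx) (NetworkLQR.Idx nu) ℝ)
      (Q : Matrix (NetworkLQR.Idx nx) (NetworkLQR.Idx nx) ℝ)
      (R : Matrix (NetworkLQR.Idx nu) (NetworkLQR.Idx nu) ℝ)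
      (S : Matrix (NetworkLQR.Idx nu) (NetworkLQR.Idx nx) ℝ)
      (_ : Q.PosDef) (_ : (R - S * Q⁻¹ * Sᵀ).PosDef)
      (γsys a b q r s : ℝ) (_ : 0 < γsys)
      (_ : 1 ≤ a) (_ : 1 ≤ b) (_ : 1 ≤ q) (_ : 1 ≤ r) (_ : 0 < s)
      (_ : NetworkLQR.IsSED d a γsys A) (_ : NetworkLQR.IsSED d b γsys B)
      (_ : NetworkLQR.IsSED d q γsys Q) (_ : NetworkLQR.IsSED d r γsys R)
      (_ : NetworkLQR.IsSED d s γsys S)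
      (τ ρ : ℝ) (_ : 1 ≤ τ) (_ : 0 < ρ)
      (k₀ : ℝ) (_ : 0 ≤ k₀) (K₀ : Matrix (NetworkLQR.Idx nu) (NetworkLQR.Idx nx) ℝ)
      (_ : NetworkLQR.IsSED d k₀ γsys K₀) (_ : NetworkLQR.IsExpStable τ ρ (A - B * K₀))
      (Ω : Type) (_ : MeasurableSpace Ω) (μ : Measure Ω) (_ : IsProbabilityMeasure μ)
      (w : ℕ → Ω → NetworkLQR.Idx nx → ℝ) (_ : NetworkLQR.IsWhiteNoise μ w)
      (K : Matrix (NetworkLQR.Idx nu) (NetworkLQR.Idx nx) ℝ)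
      (_ : NetworkLQR.IsOptimalGain A B Q R S μ w K)
      (_ : NetworkLQR.IsExpStable τ ρ (A - B * K)),
      0 < Pγ.eval
          ![τ, 1 / (1 - Real.exp (-2 * ρ)),
            1 / NetworkLQR.lamMin (R - S * Q⁻¹ * Sᵀ), 1 / NetworkLQR.lamMin Q,
            NetworkLQR.lamMax R, ‖B‖, ‖Q‖, ‖R‖, ‖S‖, ‖K₀‖ ^ 2,
            Real.log N, Real.log a, Real.log b, Real.log q, Real.log r,
            Real.log (1 + s), Real.log (1 + k₀), Real.log (1 + γsys)] ∧
      NetworkLQR.IsSED d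
        (Pc.eval
          ![(N : ℝ), τ, 1 / (1 - Real.exp (-2 * ρ)),
            1 / NetworkLQR.lamMin (R - S * Q⁻¹ * Sᵀ), 1 / NetworkLQR.lamMin Q,
            ‖B‖, ‖Q‖, ‖R‖, ‖S‖, ‖K‖, ‖K₀‖ ^ 2, b, q, r, s, k₀])
        (γsys * ρ / ((1 + ρ) * Pγ.eval
          ![τ, 1 / (1 - Real.exp (-2 * ρ)),
            1 / NetworkLQR.lamMin (R - S * Q⁻¹ * Sᵀ), 1 / NetworkLQR.lamMin Q,
            NetworkLQR.lamMax R, ‖B‖, ‖Q‖, ‖R‖, ‖S‖, ‖K₀‖ ^ 2,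
            Real.log N, Real.log a, Real.log b, Real.log q, Real.log r,
            Real.log (1 + s), Real.log (1 + k₀), Real.log (1 + γsys)])) K := by
  refine ⟨NetworkLQR.decayConst (.X 1) (.X 2) (.X 6) (.X 7) (.X 8) (.X 9),
    NetworkLQR.decayDenom (.X 0) (.X 1) (.X 2) (.X 3) (.X 5) (.X 6) (.X 7) (.X 8) (.X 9)
      (.X 10 + .X 11 + .X 12 + .X 13 + .X 14 + .X 15), ?_⟩
  intro N d hd nx nu A B Q R S hQ hR γsys a b q r s hγ ha hb hq hr hs hA hB hQs hRs hSs τ ρ hτ hρ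
    k₀ _ K₀ _ hK₀ Ω _ μ _ w hw K hopt hK
  have hlog : 0 ≤ Real.log N + Real.log a + Real.log b + Real.log q + Real.log r +
      Real.log (1 + s) := by
    have h1 := Real.log_natCast_nonneg N
    have h2 := Real.log_nonneg ha
    have h3 := Real.log_nonneg hb
    have h4 := Real.log_nonneg hq
    have h5 := Real.log_nonneg hr
    have h6 := Real.log_nonneg (show 1 ≤ 1 + s by linarith)
    linarith
  have hg : 0 ≤ 1 / (1 - Real.exp (-2 * ρ)) :=
    div_nonneg zero_le_one (by linarith [NetworkLQR.exp_neg_two_mul_lt_one hρ])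
  have hD := NetworkLQR.one_le_decayDenom (by linarith : 0 ≤ τ) hg
    (one_div_nonneg.mpr (NetworkLQR.lamMin_nonneg hR))
    (one_div_nonneg.mpr (NetworkLQR.lamMin_nonneg hQ)) (norm_nonneg B) (norm_nonneg Q)
    (norm_nonneg R) (norm_nonneg S) (sq_nonneg ‖K₀‖) hlog
  have hmain := NetworkLQR.isSED_of_riccati hd hQ hR hγ.le ha hb hq hr hs.le hA hB hQs hRs hSs hτ hρ
    hK₀ (NetworkLQR.riccati_of_isOptimalGain hQ hR hρ hw hopt hK) hK
  simp only [NetworkLQR.map_decayDenom, NetworkLQR.map_decayConst, map_add, MvPolynomial.eval_X]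
  exact ⟨zero_lt_one.trans_le hD, hmain⟩
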